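/- Let $d\ge 1$ be an integer, let $\mathcal S_d$ be the Euclidean unit sphere of $\mathbb R^{d+1}$ and let $\sigma$ be the normalized surface measure on $\mathcal S_d$. For $f\in L^1(\mathcal S_d)$ (real or complex valued) let $$P[f](x)=\int_{\mathcal S_d}\frac{1-\|x\|^2}{\|x-\xi\|^{d+1}}\,f(\xi)\,d\sigma(\xi)\qquad(\|x\|<1)$$ be its Poisson integral. For $\beta\ge 0$ define, with the convention $\log 0=-\infty$, $$\mathcal E^+(\beta,f)=\Big\{x\in\mathcal S_d:\ \liminf_{r\to1^-}\frac{\log|P[f](rx)|}{-\log(1-r)}\ge\beta\Big\},\qquad E^+(\beta,f)=\Big\{x\in\mathcal S_d:\ \liminf_{r\to1^-}\frac{\log|P[f](rx)|}{-\log(1-r)}=\beta\Big\},$$ $$E(\beta,f)=\Big\{x\in\mathcal S_d:\ \lim_{r\to1^-}\frac{\log|P[f](rx)|}{-\log(1-r)}\text{ exists and equals }\beta\Big\}.$$ Let $\dim_{\mathcal H}$ and $\dim_{\mathcal P}$ denote the Hausdorff and the packing dimension (both equal to $0$ for the empty set). (i) For every $f\in L^1(\mathcal S_d)$ and every $\beta\in[0,d]$,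 $\dim_{\mathcal P}\big(\mathcal E^+(\beta,f)\big)\le d-\beta$. (ii) There exists a nonnegative function $f\in L^1(\mathcal S_d)$ such that, for all $\beta\in[0,d]$, $$\dim_{\mathcal H}\big(E(\beta,f)\big)=\dim_{\mathcal P}\big(E(\beta,f)\big)=d-\beta,$$ and in particular $\dim_{\mathcal P}\big(E^+(\beta,f)\big)=d-\beta$. -/

import Mathlib

open MeasureTheory Set Filter Topology
open scoped ENNReal NNReal

noncomputable section

/-! ### Packing measures and packing dimension -/

namespace Packing

variable {X : Type*} [PseudoMetricSpace X]

/-- `IsPacking δ F P`: the set `P` of pairs (centre, radius) describes a family of pairwise disjoint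
closed balls with centres in `F` and radii in `(0, δ]`. -/
def IsPacking (δ : ℝ) (F : Set X) (P : Set (X × ℝ)) : Prop :=
  (∀ p ∈ P, p.1 ∈ F ∧ 0 < p.2 ∧ p.2 ≤ δ) ∧
    P.PairwiseDisjoint fun p => Metric.closedBall p.1 p.2

/-- `𝒫^s_δ(F)`: the supremum of `∑ (2 rᵢ)^s` over all packings of `F` by balls of radii
`rᵢ ≤ δ`. -/
def packingPreDelta (s : ℝ≥0) (δ : ℝ) (F : Set X) : ℝ≥0∞ :=
  ⨆ (P : Set (X × ℝ)) (_ : IsPacking δ F P),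
    ∑' p : P, ENNReal.ofReal (2 * p.1.2) ^ (s : ℝ)

/-- The packing premeasure `𝒫^s_0(F)`: the limit, which is the infimum, of `𝒫^s_δ(F)` as `δ`
decreases to `0`. -/
def packingPre (s : ℝ≥0) (F : Set X) : ℝ≥0∞ :=
  ⨅ (δ : ℝ) (_ : 0 < δ), packingPreDelta s δ F

/-- The `s`-dimensional packing (outer) measure
`𝒫^s(F) = inf {∑ᵢ 𝒫^s_0(Gᵢ) : F ⊆ ⋃ᵢ Gᵢ}`. -/
def packingMeasure (s : ℝ≥0) (F : Set X) : ℝ≥0∞ :=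
  ⨅ (G : ℕ → Set X) (_ : F ⊆ ⋃ i, G i), ∑' i, packingPre s (G i)

/-- The packing dimension `sup {s ≥ 0 : 𝒫^s(F) = ∞}`; it is `0` for the empty set. -/
def dimP (F : Set X) : ℝ≥0∞ :=
  ⨆ (s : ℝ≥0) (_ : packingMeasure s F = ∞), (s : ℝ≥0∞)

end Packing

/-! ### Radial behaviour of Poisson integrals -/

namespace RadialPoisson

/-- The Euclidean space `ℝ^{d+1}`. -/
abbrev Space (d : ℕ) : Type := EuclideanSpace ℝ (Fin (d + 1))

/-- The Euclidean unit sphere of `ℝ^{d+1}`. -/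
abbrev Sph (d : ℕ) : Type := Metric.sphere (0 : Space d) 1

/-- The normalized surface measure on the unit sphere. -/
def sigma (d : ℕ) : Measure (Sph d) :=
  ((volume : Measure (Space d)).toSphere univ)⁻¹ • (volume : Measure (Space d)).toSphere

/-- The Poisson kernel `(1 - ‖x‖²) / ‖x - ξ‖^{d+1}`. -/
def poissonKernel (d : ℕ) (x : Space d) (ξ : Sph d) : ℝ :=
  (1 - ‖x‖ ^ 2) / ‖x - (ξ : Space d)‖ ^ (d + 1)

variable {d : ℕ} {𝕜 : Type*} [RCLike 𝕜]

/-- The Poisson integral `P[f](x)` of a real or complex function `f` on the sphere. -/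
def poissonIntegral (f : Sph d → 𝕜) (x : Space d) : 𝕜 :=
  ∫ ξ, ((poissonKernel d x ξ : ℝ) : 𝕜) * f ξ ∂(sigma d)

/-- The quotient `log |P[f](r x)| / (- log (1 - r))`, with the convention `log 0 = -∞`. -/
def radialExponent (f : Sph d → 𝕜) (x : Space d) (r : ℝ) : EReal :=
  ENNReal.log ‖poissonIntegral f (r • x)‖ₑ / ((-Real.log (1 - r) : ℝ) : EReal)

/-- The points `x` of the sphere where `liminf_{r → 1} log |P[f](r x)| / (- log (1 - r)) ≥ β`. -/
def superLevelSet (f : Sph d → 𝕜) (β : ℝ) : Set (Space d) :=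
  {x | x ∈ Metric.sphere (0 : Space d) 1 ∧
    (β : EReal) ≤ liminf (radialExponent f x) (𝓝[<] (1 : ℝ))}

/-- The points `x` of the sphere where `liminf_{r → 1} log |P[f](r x)| / (- log (1 - r)) = β`. -/
def liminfLevelSet (f : Sph d → 𝕜) (β : ℝ) : Set (Space d) :=
  {x | x ∈ Metric.sphere (0 : Space d) 1 ∧
    liminf (radialExponent f x) (𝓝[<] (1 : ℝ)) = (β : EReal)}

/-- The points `x` of the sphere where the limit of `log |P[f](r x)| / (- log (1 - r))` as `r → 1`
exists and equals `β`. -/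
def limLevelSet (f : Sph d → 𝕜) (β : ℝ) : Set (Space d) :=
  {x | x ∈ Metric.sphere (0 : Space d) 1 ∧
    Tendsto (radialExponent f x) (𝓝[<] (1 : ℝ)) (𝓝 (β : EReal))}

end RadialPoisson

end

/-! At height `h = 1 - r` the Poisson kernel is comparable to `h / (h + D)^{d+1}`, where `D` is the
distance on the sphere.

Upper bound. Let `s > d - β`, and choose `γ < β` and `η > 0` with `s + γ = d + 2η`. The superlevel
set is a countable union of sets on which `|P[f]| ≥ h^{-γ}` at all heights below a fixed one. On a
packing of such a set by balls `B(xᵢ, rᵢ)` with `rᵢ ≤ δ`, evaluation at height `rᵢ` bounds `∑ rᵢ^s`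
by a multiple of `δ^η ∫ |f(ξ)| ∑ rᵢ^{d+η} rᵢ / (rᵢ + |xᵢ - ξ|)^{d+1} dσ(ξ)`. The inner sum is
bounded uniformly in `ξ` and in the packing (`sum_decayKernel_packing_le`): each term is at most a
constant times the integral of `|y - ξ|^{η-(d+1)}` over `B(xᵢ, rᵢ)`, the balls are disjoint in
`ℝ^{d+1}`, and the singularity is integrable. Letting `δ → 0` kills the premeasure.

Saturation. Give every binary position a level in `[0, 1)`, equidistributed up to an error `O(√n)`
among the first `n`. For `t ∈ [0, 1]` take a random point of the cube whose digits are `0` at levels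
below `t` and fair coins elsewhere, and send it to the sphere. Its law `μ_t` satisfies Frostman
estimates for every exponent below `d(1 - t)` (`exists_coins_spherePoint_le`). The function is `f(ξ)
= ∑ₙ ∑_{j ≤ n} 2^{nd} (n+1)^{-3} μ_{j/n}(B(ξ, (2d+3) 2^{-n}))`, which is integrable. At every point
built with parameter `t`, the term `j = ⌊tn⌋` forces growth of exponent at least `dt`
(`exists_rpow_le_saturatingPotential`). At `μ_t`-almost every point the exponent is at most `dt`, by
Fubini and the potential estimate for `μ_t` (`ae_exists_saturatingPotential_le`). So `μ_t` is
carried by `E(dt, f)`, whose Hausdorff dimension is therefore at least `d - dt`; the upper bound and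
`dimH ≤ dimP` close the chain. -/

namespace Packing

/-! ### Packing measure against Hausdorff measure -/

theorem packingPreDelta_mono {X : Type*} [PseudoMetricSpace X] (s : ℝ≥0) {δ δ' : ℝ} (h : δ ≤ δ')
    (F : Set X) : packingPreDelta s δ F ≤ packingPreDelta s δ' F := by
  refine iSup₂_le fun P hP => ?_
  exact le_iSup₂_of_le P ⟨fun p hp => ⟨(hP.1 p hp).1, (hP.1 p hp).2.1, (hP.1 p hp).2.2.trans h⟩,
    hP.2⟩ le_rfl

theorem packingMeasure_mono (s : ℝ≥0) {X : Type*} [PseudoMetricSpace X] {F G : Set X} (h : F ⊆ G) :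
    packingMeasure s F ≤ packingMeasure s G :=
  le_iInf₂ fun H hH => iInf₂_le H (h.trans hH)

theorem dimP_mono {X : Type*} [PseudoMetricSpace X] {F G : Set X} (h : F ⊆ G) : dimP F ≤ dimP G := by
  refine iSup₂_le fun s hs => le_iSup₂_of_le s ?_ le_rfl
  exact top_le_iff.1 (hs ▸ packingMeasure_mono s h)

variable {X : Type*} [MetricSpace X]

/-- A maximal packing by balls of a fixed radius gives a cover by balls of five times the radius. -/
theorem exists_finite_cover (s : ℝ≥0) {δ : ℝ} (hδ : 0 < δ) (F : Set X)
    (hfin : packingPreDelta s δ F ≠ ∞) :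
    ∃ u : Finset X, F ⊆ ⋃ x : u, Metric.closedBall (x : X) (5 * δ) ∧
      (u.card : ℝ≥0∞) * ENNReal.ofReal (2 * δ) ^ (s : ℝ) ≤ packingPreDelta s δ F := by
  obtain ⟨u, huF, hdisj, hcov⟩ := Vitali.exists_disjoint_subfamily_covering_enlargement_closedBall
    F id (fun _ => δ) δ (fun _ _ => le_rfl) 5 (by norm_num)
  have hpack : IsPacking δ F ((fun x => (x, δ)) '' u) := by
    refine ⟨?_, ?_⟩
    · rintro _ ⟨x, hx, rfl⟩
      exact ⟨huF hx, hδ, le_rfl⟩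
    · rintro _ ⟨x, hx, rfl⟩ _ ⟨y, hy, rfl⟩ hxy
      exact hdisj hx hy fun h => hxy (by simp [h])
  have hsum : ∑' _ : u, ENNReal.ofReal (2 * δ) ^ (s : ℝ) ≤ packingPreDelta s δ F := by
    refine le_trans (le_of_eq ?_) (le_iSup₂_of_le _ hpack le_rfl)
    have hinj : Function.Injective fun x : X => (x, δ) := fun x y h => (Prod.ext_iff.1 h).1
    rw [tsum_image (f := fun p : X × ℝ => ENNReal.ofReal (2 * p.2) ^ (s : ℝ)) hinj.injOn]
  have hpos : ENNReal.ofReal (2 * δ) ^ (s : ℝ) ≠ 0 := by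
    rw [Ne, ENNReal.rpow_eq_zero_iff]
    push Not
    exact ⟨fun h => absurd h (by simpa using hδ), fun h => absurd h ENNReal.ofReal_ne_top⟩
  have hufin : u.Finite := by
    by_contra hinf
    have : Infinite u := Set.infinite_coe_iff.2 hinf
    rw [ENNReal.tsum_const_eq_top_of_ne_zero hpos] at hsum
    exact hfin (top_le_iff.1 hsum)
  refine ⟨hufin.toFinset, fun x hx => ?_, ?_⟩
  · obtain ⟨b, hb, hsub⟩ := hcov x hx
    exact mem_iUnion.2 ⟨⟨b, hufin.mem_toFinset.2 hb⟩, hsub (Metric.mem_closedBall_self hδ.le)⟩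
  · refine le_trans (le_of_eq ?_) hsum
    rw [ENNReal.tsum_const, ← Set.encard, hufin.encard_eq_coe_toFinset_card]
    rfl

variable [MeasurableSpace X] [BorelSpace X]

/-- The covers given by maximal packings of radius `δ / (n + 1)` have diameters tending to `0`, and
enlarging the balls five times costs a factor `5 ^ s` in their sums. -/
theorem hausdorffMeasure_le_packingPreDelta (s : ℝ≥0) {δ : ℝ} (hδ : 0 < δ) (F : Set X) :
    μH[s] F ≤ 5 ^ (s : ℝ) * packingPreDelta s δ F := by
  by_cases hfin : packingPreDelta s δ F = ∞
  · rw [hfin, ENNReal.mul_top]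
    · exact le_top
    · simp
  have hδn : ∀ n : ℕ, 0 < δ / (n + 1) := fun n => by positivity
  have hle : ∀ n : ℕ, δ / (n + 1) ≤ δ := fun n => div_le_self hδ.le (by simp)
  have hfin' : ∀ n : ℕ, packingPreDelta s (δ / (n + 1)) F ≠ ∞ := fun n =>
    ne_top_of_le_ne_top hfin (packingPreDelta_mono s (hle n) F)
  choose u hu hcard using fun n => exists_finite_cover s (hδn n) F (hfin' n)
  have hdiam : ∀ n, ∀ i : u n, Metric.ediam (Metric.closedBall (i : X) (5 * (δ / (n + 1)))) ≤
      5 * ENNReal.ofReal (2 * (δ / (n + 1))) := by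
    intro n i
    rw [← Metric.closedEBall_ofReal (by have := hδn n; positivity)]
    refine Metric.ediam_closedEBall_le.trans (le_of_eq ?_)
    rw [ENNReal.ofReal_mul (by norm_num), ENNReal.ofReal_mul (by norm_num)]
    simp only [ENNReal.ofReal_ofNat]
    ring
  have key := Measure.hausdorffMeasure_le_liminf_sum (l := atTop) (ι := fun n => u n) (s : ℝ) F
    (fun n : ℕ => 5 * ENNReal.ofReal (2 * (δ / (n + 1)))) ?_
    (fun n i => Metric.closedBall (i : X) (5 * (δ / (n + 1))))
    (Eventually.of_forall hdiam) (Eventually.of_forall hu)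
  · refine key.trans (liminf_le_of_le (by isBoundedDefault) fun b hb => ?_)
    obtain ⟨n, hn⟩ := hb.exists
    refine hn.trans ?_
    calc ∑ i : u n, Metric.ediam (Metric.closedBall (i : X) (5 * (δ / (n + 1)))) ^ (s : ℝ)
        ≤ ∑ i : u n, (5 * ENNReal.ofReal (2 * (δ / (n + 1)))) ^ (s : ℝ) :=
          Finset.sum_le_sum fun i _ => ENNReal.rpow_le_rpow (hdiam n i) s.2
      _ = 5 ^ (s : ℝ) * ((u n).card * ENNReal.ofReal (2 * (δ / (n + 1))) ^ (s : ℝ)) := by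
          simp only [ENNReal.mul_rpow_of_nonneg _ _ s.coe_nonneg, Finset.sum_const, nsmul_eq_mul,
            Finset.card_univ, Fintype.card_coe]
          ring
      _ ≤ _ := by
          gcongr
          exact (hcard n).trans (packingPreDelta_mono s (hle n) F)
  · have h1 : Tendsto (fun n : ℕ => 2 * (δ / ((n : ℝ) + 1))) atTop (𝓝 (2 * 0)) :=
      (tendsto_const_nhds.div_atTop
        (tendsto_atTop_add_const_right _ _ tendsto_natCast_atTop_atTop)).const_mul 2
    have h2 := ENNReal.Tendsto.const_mul (a := 5) (ENNReal.tendsto_ofReal h1)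
      (Or.inr (by norm_num))
    simpa using h2

theorem hausdorffMeasure_le_packingMeasure (s : ℝ≥0) (F : Set X) :
    μH[s] F ≤ 5 ^ (s : ℝ) * packingMeasure s F := by
  have h5 : (5 : ℝ≥0∞) ^ (s : ℝ) ≠ ∞ := by simp
  have h5' : (5 : ℝ≥0∞) ^ (s : ℝ) ≠ 0 := by simp
  have hpre : ∀ G : Set X, μH[s] G ≤ 5 ^ (s : ℝ) * packingPre s G := by
    intro G
    rw [mul_comm, ← ENNReal.div_le_iff h5' h5]
    refine le_iInf₂ fun δ hδ => ?_
    rw [ENNReal.div_le_iff h5' h5, mul_comm]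
    exact hausdorffMeasure_le_packingPreDelta s hδ G
  rw [mul_comm, ← ENNReal.div_le_iff h5' h5]
  refine le_iInf₂ fun G hG => ?_
  rw [ENNReal.div_le_iff h5' h5, mul_comm, ← ENNReal.tsum_mul_left]
  exact (measure_mono hG).trans ((measure_iUnion_le G).trans (ENNReal.tsum_le_tsum fun i => hpre _))

theorem dimH_le_dimP (F : Set X) : dimH F ≤ dimP F := by
  refine dimH_le fun s hs => le_iSup₂_of_le s ?_ le_rfl
  have := hausdorffMeasure_le_packingMeasure s F
  rw [hs, top_le_iff] at this
  by_contra h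
  exact ENNReal.mul_ne_top (by simp) h this

end Packing

/-! ### Comparison of the Poisson kernel with a model kernel -/

namespace RadialPoisson

/-- The model kernel `h / (h + D)^{d+1}`, comparable to the Poisson kernel at height `h` and
distance `D`. -/
noncomputable def decayKernel (d : ℕ) (h D : ℝ) : ℝ := h / (h + D) ^ (d + 1)

theorem norm_smul_sub_le {d : ℕ} {x : Space d} (hx : ‖x‖ = 1) {r : ℝ} (hr : r < 1) (y : Space d) :
    ‖r • x - y‖ ≤ (1 - r) + ‖x - y‖ := by
  have h : r • x - y = (x - y) - (1 - r) • x := by module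
  rw [h]
  refine (norm_sub_le _ _).trans ?_
  rw [norm_smul, hx, mul_one, Real.norm_of_nonneg (by linarith)]
  linarith

theorem le_norm_smul_sub {d : ℕ} {x : Space d} (hx : ‖x‖ = 1) {r : ℝ} (hr0 : 0 < r) (hr : r < 1)
    {y : Space d} (hy : ‖y‖ = 1) : (1 - r) + ‖x - y‖ ≤ 3 * ‖r • x - y‖ := by
  have h1 : 1 - r ≤ ‖r • x - y‖ := by
    have := norm_sub_norm_le y (r • x)
    rw [norm_smul, hx, hy, mul_one, Real.norm_of_nonneg hr0.le, norm_sub_rev] at this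
    exact this
  have h2 : ‖x - y‖ ≤ (1 - r) + ‖r • x - y‖ := by
    have h : x - y = (r • x - y) + (1 - r) • x := by module
    rw [h]
    refine (norm_add_le _ _).trans ?_
    rw [norm_smul, hx, mul_one, Real.norm_of_nonneg (by linarith)]
    linarith
  linarith

theorem one_sub_norm_sq {d : ℕ} {x : Space d} (hx : ‖x‖ = 1) (r : ℝ) :
    1 - ‖r • x‖ ^ 2 = (1 - r) * (1 + r) := by
  rw [norm_smul, hx, mul_one, Real.norm_eq_abs, sq_abs]; ring

theorem poissonKernel_le {d : ℕ} {x : Space d} (hx : ‖x‖ = 1) {r : ℝ} (hr0 : 0 < r) (hr : r < 1)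
    (ξ : Sph d) :
    poissonKernel d (r • x) ξ ≤ 2 * 3 ^ (d + 1) * decayKernel d (1 - r) ‖x - ξ‖ := by
  have hξ : ‖(ξ : Space d)‖ = 1 := by simp
  have hle := le_norm_smul_sub hx hr0 hr hξ
  have hpos : 0 < (1 - r) + ‖x - ξ‖ := by have := norm_nonneg (x - ξ); linarith
  unfold poissonKernel decayKernel
  rw [one_sub_norm_sq hx]
  have hpow := pow_le_pow_left₀ hpos.le hle (d + 1)
  rw [mul_pow] at hpow
  have hp2 : 0 < ((1 - r) + ‖x - ξ‖) ^ (d + 1) := by positivity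
  have hp3 : 0 < ‖r • x - ξ‖ ^ (d + 1) := by
    have : 0 < ‖r • x - ξ‖ := by linarith
    positivity
  rw [← mul_div_assoc, div_le_div_iff₀ hp3 hp2]
  have h1 : (1 - r) * (1 + r) ≤ 2 * (1 - r) := by nlinarith
  calc (1 - r) * (1 + r) * ((1 - r) + ‖x - ξ‖) ^ (d + 1)
      ≤ (2 * (1 - r)) * (3 ^ (d + 1) * ‖r • x - ξ‖ ^ (d + 1)) := by
        apply mul_le_mul h1 hpow hp2.le (by linarith)
    _ = _ := by ring

theorem decayKernel_le_poissonKernel {d : ℕ} {x : Space d} (hx : ‖x‖ = 1) {r : ℝ} (hr0 : 0 < r)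
    (hr : r < 1) (ξ : Sph d) :
    decayKernel d (1 - r) ‖x - ξ‖ ≤ poissonKernel d (r • x) ξ := by
  have hξ : ‖(ξ : Space d)‖ = 1 := by simp
  have hle := le_norm_smul_sub hx hr0 hr hξ
  have hpos : 0 < (1 - r) + ‖x - ξ‖ := by have := norm_nonneg (x - ξ); linarith
  have hpos' : 0 < ‖r • x - ξ‖ := by linarith
  unfold poissonKernel decayKernel
  rw [one_sub_norm_sq hx]
  apply div_le_div₀ (by nlinarith) (by nlinarith) (by positivity)
  exact pow_le_pow_left₀ hpos'.le (norm_smul_sub_le hx hr _) _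

theorem poissonKernel_nonneg {d : ℕ} {x : Space d} (hx : ‖x‖ ≤ 1) (ξ : Sph d) :
    0 ≤ poissonKernel d x ξ := by
  unfold poissonKernel
  have : ‖x‖ ^ 2 ≤ 1 := pow_le_one₀ (norm_nonneg _) hx
  exact div_nonneg (by linarith) (by positivity)

theorem measurable_decayKernel (d : ℕ) (h : ℝ) : Measurable (decayKernel d h) := by
  unfold decayKernel; fun_prop

/-! ### Radial exponents as power bounds -/

section Exponent

variable {d : ℕ} {𝕜 : Type*} [RCLike 𝕜] {f : Sph d → 𝕜} {x : Space d} {r : ℝ}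

theorem neg_log_one_sub_pos (hr0 : 0 < r) (hr : r < 1) : 0 < -Real.log (1 - r) := by
  have := Real.log_neg (x := 1 - r) (by linarith) (by linarith)
  linarith

theorem coe_mul_neg_log (γ : ℝ) (hr : r < 1) :
    (γ : EReal) * ((-Real.log (1 - r) : ℝ) : EReal) =
      ENNReal.log (ENNReal.ofReal ((1 - r) ^ (-γ))) := by
  have h : 0 < 1 - r := by linarith
  rw [ENNReal.log_ofReal_of_pos (Real.rpow_pos_of_pos h _), Real.log_rpow h, ← EReal.coe_mul]
  congr 1; ring

theorem le_radialExponent_iff (γ : ℝ) (hr0 : 0 < r) (hr : r < 1) :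
    (γ : EReal) ≤ radialExponent f x r ↔
      ENNReal.ofReal ((1 - r) ^ (-γ)) ≤ ‖poissonIntegral f (r • x)‖ₑ := by
  rw [radialExponent, EReal.le_div_iff_mul_le (EReal.coe_pos.2 (neg_log_one_sub_pos hr0 hr))
    (EReal.coe_ne_top _), coe_mul_neg_log γ hr, ENNReal.log_le_log_iff]

theorem radialExponent_le_iff (γ : ℝ) (hr0 : 0 < r) (hr : r < 1) :
    radialExponent f x r ≤ (γ : EReal) ↔
      ‖poissonIntegral f (r • x)‖ₑ ≤ ENNReal.ofReal ((1 - r) ^ (-γ)) := by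
  rw [radialExponent, EReal.div_le_iff_le_mul (EReal.coe_pos.2 (neg_log_one_sub_pos hr0 hr))
    (EReal.coe_ne_top _), mul_comm, coe_mul_neg_log γ hr, ENNReal.log_le_log_iff]

theorem eventually_Ioo_nhdsLT_one : ∀ᶠ r : ℝ in 𝓝[<] 1, r ∈ Ioo (0 : ℝ) 1 :=
  Ioo_mem_nhdsLT one_pos

/-- An integer threshold turns the superlevel set into a countable union of sets with a uniform
bound. The offset `2` keeps the height `1 / (n + 2)` below `1` even for `n = 0`. -/
theorem exists_le_of_mem_superLevelSet {β γ : ℝ} (hγ : γ < β) (hx : x ∈ superLevelSet f β) :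
    ∃ n : ℕ, ∀ r : ℝ, 1 - 1 / ((n : ℝ) + 2) ≤ r → r < 1 →
      ENNReal.ofReal ((1 - r) ^ (-γ)) ≤ ‖poissonIntegral f (r • x)‖ₑ := by
  have h1 : (γ : EReal) < liminf (radialExponent f x) (𝓝[<] (1 : ℝ)) :=
    (EReal.coe_lt_coe_iff.2 hγ).trans_le hx.2
  have h2 := (eventually_lt_of_lt_liminf h1).and eventually_Ioo_nhdsLT_one
  obtain ⟨a, ha, hsub⟩ := (mem_nhdsLT_iff_exists_Ioo_subset' zero_lt_one).1 h2
  obtain ⟨n, hn⟩ := exists_nat_one_div_lt (sub_pos.2 (show a < 1 from ha))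
  refine ⟨n, fun r hr hr1 => ?_⟩
  have h3 : 1 / ((n : ℝ) + 2) ≤ 1 / ((n : ℝ) + 1) := by gcongr; norm_num
  obtain ⟨h4, h5⟩ := hsub (show r ∈ Ioo a 1 from ⟨by linarith, hr1⟩)
  exact (le_radialExponent_iff γ h5.1 hr1).1 h4.le

theorem enorm_poissonIntegral_le (hx : ‖x‖ = 1) (hr0 : 0 < r) (hr : r < 1) :
    ‖poissonIntegral f (r • x)‖ₑ ≤ 2 * 3 ^ (d + 1) *
      ∫⁻ ξ, ENNReal.ofReal (decayKernel d (1 - r) ‖x - ξ‖) * ‖f ξ‖ₑ ∂(sigma d) := by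
  rw [← lintegral_const_mul' _ _ (by finiteness)]
  refine (enorm_integral_le_lintegral_enorm _).trans (lintegral_mono fun ξ => ?_)
  have hrx : ‖r • x‖ ≤ 1 := by
    rw [norm_smul, hx, mul_one, Real.norm_of_nonneg hr0.le]; exact hr.le
  rw [enorm_mul, ← mul_assoc]
  gcongr
  rw [← ofReal_norm, RCLike.norm_ofReal, abs_of_nonneg (poissonKernel_nonneg hrx ξ)]
  refine (ENNReal.ofReal_le_ofReal (poissonKernel_le hx hr0 hr ξ)).trans (le_of_eq ?_)
  rw [ENNReal.ofReal_mul (by positivity), ENNReal.ofReal_mul (by positivity),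
    ENNReal.ofReal_pow (by positivity)]
  simp

end Exponent

/-! ### Upper bound for the packing dimension -/

section Packing

open Packing

/-- In polar coordinates the integrand becomes `t ^ (η - 1)`. The radius `3` suffices because a ball
of radius at most `1` centred on the sphere lies within `3` of any point of the sphere. -/
theorem lintegral_enorm_rpow_lt_top (d : ℕ) {η : ℝ} (hη : 0 < η) :
    ∫⁻ y in Metric.closedBall (0 : Space d) 3, ‖y‖ₑ ^ (η - (d + 1)) < ∞ := by
  have hint : IntegrableOn (fun x : Space d => ‖x‖ ^ (η - (d + 1))) (Metric.ball 0 4) := by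
    rw [integrableOn_fun_norm_addHaar volume (f := fun t : ℝ => t ^ (η - (d + 1)))]
    simp only [finrank_euclideanSpace_fin, Nat.add_sub_cancel, smul_eq_mul]
    have h0 : IntegrableOn (fun t : ℝ => t ^ (η - 1)) (Ioo 0 4) :=
      (intervalIntegrable_iff_integrableOn_Ioo_of_le (by norm_num)).1
        (intervalIntegral.intervalIntegrable_rpow' (by linarith))
    refine h0.congr_fun (fun t ht => ?_) measurableSet_Ioo
    have : (t : ℝ) ^ d = t ^ (d : ℝ) := (Real.rpow_natCast t d).symm
    simp only [this]
    rw [← Real.rpow_add ht.1]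
    congr 1; ring
  have hfin := hint.2
  refine lt_of_le_of_lt ?_ hfin
  calc ∫⁻ y in Metric.closedBall (0 : Space d) 3, ‖y‖ₑ ^ (η - (d + 1))
      ≤ ∫⁻ y in Metric.ball (0 : Space d) 4, ‖y‖ₑ ^ (η - (d + 1)) :=
        lintegral_mono_set (Metric.closedBall_subset_ball (by norm_num))
    _ = ∫⁻ y in Metric.ball (0 : Space d) 4, ‖‖y‖ ^ (η - (d + 1))‖ₑ := by
        refine lintegral_congr_ae (ae_restrict_of_ae ?_)
        have : ∀ᵐ y : Space d, y ≠ 0 := by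
          simp [ae_iff]
        filter_upwards [this] with y hy
        have hy' : 0 < ‖y‖ := norm_pos_iff.2 hy
        rw [← ofReal_norm y, ENNReal.ofReal_rpow_of_pos hy',
          Real.enorm_of_nonneg (by positivity)]

/-- The constant of `sum_decayKernel_packing_le`. -/
noncomputable def packingConst (d : ℕ) (η : ℝ) : ℝ≥0∞ :=
  (volume (Metric.ball (0 : Space d) 1))⁻¹ *
    ∫⁻ y in Metric.closedBall (0 : Space d) 3, ‖y‖ₑ ^ (η - (d + 1))

theorem packingConst_lt_top (d : ℕ) {η : ℝ} (hη : 0 < η) : packingConst d η < ∞ :=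
  ENNReal.mul_lt_top (ENNReal.inv_lt_top.2 (Metric.measure_ball_pos _ _ one_pos))
    (lintegral_enorm_rpow_lt_top d hη)

/-- On the ball the distance to `ξ` is at most `r + D`, and the exponent is nonpositive, so the
integral is at least `(r + D)^{η-(d+1)}` times the volume, of order `r^{d+1}`. It remains to use
`r^η ≤ (r + D)^η`. -/
theorem decayKernel_packing_le_lintegral (d : ℕ) {η : ℝ} (hη1 : η ≤ 1)
    (x ξ : Space d) {r : ℝ} (hr : 0 < r) (hη : 0 < η) :
    ENNReal.ofReal (r ^ ((d : ℝ) + η) * decayKernel d r ‖x - ξ‖) ≤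
      (volume (Metric.ball (0 : Space d) 1))⁻¹ *
        ∫⁻ y in Metric.closedBall x r, ‖y - ξ‖ₑ ^ (η - (d + 1)) := by
  have hv0 : volume (Metric.ball (0 : Space d) 1) ≠ 0 := (Metric.measure_ball_pos _ _ one_pos).ne'
  have hvt : volume (Metric.ball (0 : Space d) 1) ≠ ∞ := measure_ball_lt_top.ne
  set D := ‖x - ξ‖ with hD
  have hD0 : 0 ≤ D := norm_nonneg _
  have hrD : 0 < r + D := by linarith
  have hvol : volume (Metric.closedBall x r) =
      ENNReal.ofReal (r ^ (d + 1)) * volume (Metric.ball (0 : Space d) 1) := by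
    rw [Measure.addHaar_closedBall _ _ hr.le, finrank_euclideanSpace_fin]
  have hlow : ENNReal.ofReal ((r + D) ^ (η - (d + 1))) * volume (Metric.closedBall x r) ≤
      ∫⁻ y in Metric.closedBall x r, ‖y - ξ‖ₑ ^ (η - (d + 1)) := by
    rw [← setLIntegral_const]
    refine setLIntegral_mono' Metric.isClosed_closedBall.measurableSet fun y hy => ?_
    rw [← ENNReal.ofReal_rpow_of_pos hrD]
    have hexp : η - (d + 1) = -((d + 1) - η) := by ring
    rw [hexp, ENNReal.rpow_neg, ENNReal.rpow_neg, ENNReal.inv_le_inv]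
    refine ENNReal.rpow_le_rpow ?_ (by have : (0 : ℝ) ≤ d := by positivity
                                       linarith)
    rw [← ofReal_norm]
    refine ENNReal.ofReal_le_ofReal ?_
    rw [mem_closedBall_iff_norm] at hy
    calc ‖y - ξ‖ = ‖(y - x) + (x - ξ)‖ := by congr 1; abel
      _ ≤ r + D := (norm_add_le _ _).trans (by linarith)
  have hreal : r ^ ((d : ℝ) + η) * decayKernel d r D ≤ (r + D) ^ (η - (d + 1)) * r ^ (d + 1) := by
    have e1 : r ^ ((d : ℝ) + η) = r ^ d * r ^ η := by
      rw [Real.rpow_add hr, Real.rpow_natCast]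
    have e2 : (r + D) ^ (η - (d + 1)) = (r + D) ^ η / (r + D) ^ (d + 1) := by
      rw [Real.rpow_sub hrD, ← Real.rpow_natCast _ (d + 1)]
      push_cast; rfl
    rw [e1, e2, decayKernel, pow_succ r d]
    have e3 : r ^ η ≤ (r + D) ^ η := Real.rpow_le_rpow hr.le (by linarith) hη.le
    have : r ^ d * r ^ η * (r / (r + D) ^ (d + 1)) = r ^ η / (r + D) ^ (d + 1) * (r ^ d * r) := by
      ring
    rw [this]
    gcongr
  calc ENNReal.ofReal (r ^ ((d : ℝ) + η) * decayKernel d r D)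
      ≤ ENNReal.ofReal ((r + D) ^ (η - (d + 1)) * r ^ (d + 1)) := ENNReal.ofReal_le_ofReal hreal
    _ = (volume (Metric.ball (0 : Space d) 1))⁻¹ *
        (ENNReal.ofReal ((r + D) ^ (η - (d + 1))) * volume (Metric.closedBall x r)) := by
        rw [hvol, ENNReal.ofReal_mul (by positivity), mul_comm (ENNReal.ofReal (r ^ (d + 1))),
          mul_left_comm, ← mul_assoc (volume _)⁻¹, ENNReal.inv_mul_cancel hv0 hvt, one_mul]
    _ ≤ _ := by gcongr

/-- Disjointness in the ambient space makes the integrals over the balls add up to at most one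
integral over `B(ξ, 3)`, which depends neither on the packing nor on `ξ`. -/
theorem sum_decayKernel_packing_le (d : ℕ) {η : ℝ} (hη : 0 < η) (hη1 : η ≤ 1) {ξ : Space d}
    (hξ : ‖ξ‖ = 1) (T : Finset (Space d × ℝ))
    (hT : IsPacking 1 (Metric.sphere (0 : Space d) 1) (T : Set (Space d × ℝ))) :
    ∑ p ∈ T, ENNReal.ofReal (p.2 ^ ((d : ℝ) + η) * decayKernel d p.2 ‖p.1 - ξ‖) ≤
      packingConst d η := by
  calc ∑ p ∈ T, ENNReal.ofReal (p.2 ^ ((d : ℝ) + η) * decayKernel d p.2 ‖p.1 - ξ‖)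
      ≤ ∑ p ∈ T, (volume (Metric.ball (0 : Space d) 1))⁻¹ *
        ∫⁻ y in Metric.closedBall p.1 p.2, ‖y - ξ‖ₑ ^ (η - (d + 1)) :=
        Finset.sum_le_sum fun p hp =>
          decayKernel_packing_le_lintegral d hη1 p.1 ξ (hT.1 p hp).2.1 hη
    _ = (volume (Metric.ball (0 : Space d) 1))⁻¹ *
        ∫⁻ y in ⋃ p ∈ T, Metric.closedBall p.1 p.2, ‖y - ξ‖ₑ ^ (η - (d + 1)) := by
        rw [lintegral_biUnion_finset hT.2 fun p _ => Metric.isClosed_closedBall.measurableSet,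
          Finset.mul_sum]
    _ ≤ (volume (Metric.ball (0 : Space d) 1))⁻¹ *
        ∫⁻ y in Metric.closedBall ξ 3, ‖y - ξ‖ₑ ^ (η - (d + 1)) := by
        gcongr
        refine iUnion₂_subset fun p hp => ?_
        obtain ⟨hp1, -, hp2⟩ := hT.1 p hp
        have hp1' : ‖p.1‖ = 1 := by simpa using hp1
        refine Metric.closedBall_subset_closedBall' ?_
        rw [dist_eq_norm]
        have := norm_sub_le p.1 ξ
        linarith
    _ = packingConst d η := by
        rw [packingConst]
        congr 1
        have h := (measurePreserving_sub_right (volume : Measure (Space d)) ξ)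
        have := h.setLIntegral_comp_preimage (s := Metric.closedBall (0 : Space d) 3)
          Metric.isClosed_closedBall.measurableSet
          (f := fun y => ‖y‖ₑ ^ (η - (d + 1))) (by fun_prop)
        rw [← this]
        congr 2
        ext y
        simp [dist_eq_norm]

/-- A ball of radius `p` is tested at height `p`: since `s = η + (d + η) - γ`, the factor `p^{-γ}`
is replaced by the Poisson integral, `p^η ≤ δ^η` gives the smallness, and `p^{d+η}` is what the
uniform kernel sum needs. -/
theorem packingPreDelta_le {d : ℕ} {𝕜 : Type*} [RCLike 𝕜] {f : Sph d → 𝕜}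
    (hf : AEMeasurable f (sigma d)) {s : ℝ≥0} {γ η : ℝ} (hη : 0 < η) (hη1 : η ≤ 1)
    (hs : (s : ℝ) + γ = d + 2 * η) {δ : ℝ} (hδ1 : δ < 1) {F : Set (Space d)}
    (hF : F ⊆ Metric.sphere 0 1)
    (hlow : ∀ x ∈ F, ∀ r : ℝ, 1 - δ ≤ r → r < 1 →
      ENNReal.ofReal ((1 - r) ^ (-γ)) ≤ ‖poissonIntegral f (r • x)‖ₑ) :
    packingPreDelta s δ F ≤ ENNReal.ofReal (δ ^ η) *
      (2 ^ (s : ℝ) * (2 * 3 ^ (d + 1)) * packingConst d η * ∫⁻ ξ, ‖f ξ‖ₑ ∂(sigma d)) := by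
  refine iSup₂_le fun P hP => ?_
  rw [ENNReal.tsum_eq_iSup_sum]
  refine iSup_le fun T => ?_
  have hsum : ∑ p ∈ T, ENNReal.ofReal (2 * p.1.2) ^ (s : ℝ) =
      ∑ p ∈ T.map (Function.Embedding.subtype _), ENNReal.ofReal (2 * p.2) ^ (s : ℝ) := by
    simp
  rw [hsum]
  set T' := T.map (Function.Embedding.subtype (· ∈ P)) with hT'
  have hTP : ∀ p ∈ T', p ∈ P := by
    intro p hp
    obtain ⟨q, -, rfl⟩ := Finset.mem_map.1 hp
    exact q.2
  have hpack : IsPacking 1 (Metric.sphere (0 : Space d) 1) (T' : Set (Space d × ℝ)) :=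
    ⟨fun p hp => ⟨hF (hP.1 p (hTP p hp)).1, (hP.1 p (hTP p hp)).2.1,
      ((hP.1 p (hTP p hp)).2.2).trans hδ1.le⟩, hP.2.subset hTP⟩
  have hterm : ∀ p ∈ T', ENNReal.ofReal (2 * p.2) ^ (s : ℝ) ≤
      ENNReal.ofReal (δ ^ η) * (2 ^ (s : ℝ) * (2 * 3 ^ (d + 1)) *
        ∫⁻ ξ, ENNReal.ofReal (p.2 ^ ((d : ℝ) + η) * decayKernel d p.2 ‖p.1 - ξ‖) * ‖f ξ‖ₑ
          ∂(sigma d)) := by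
    intro p hp
    obtain ⟨hpF, hp0, hpδ⟩ := hP.1 p (hTP p hp)
    have hp1 : ‖p.1‖ = 1 := by simpa using hF hpF
    have h1 := hlow p.1 hpF (1 - p.2) (by linarith) (by linarith)
    have h2 := h1.trans (enorm_poissonIntegral_le (f := f) hp1 (by linarith : 0 < 1 - p.2)
      (by linarith))
    rw [sub_sub_cancel] at h2
    have h3 : ENNReal.ofReal (2 * p.2) ^ (s : ℝ) =
        2 ^ (s : ℝ) * (ENNReal.ofReal (p.2 ^ η) * ENNReal.ofReal (p.2 ^ ((d : ℝ) + η)) *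
          ENNReal.ofReal (p.2 ^ (-γ))) := by
      rw [ENNReal.ofReal_mul (by norm_num), ENNReal.mul_rpow_of_nonneg _ _ s.coe_nonneg,
        ENNReal.ofReal_ofNat, ENNReal.ofReal_rpow_of_pos hp0, ← ENNReal.ofReal_mul (by positivity),
        ← ENNReal.ofReal_mul (by positivity), ← Real.rpow_add hp0, ← Real.rpow_add hp0]
      congr 4
      linarith
    have h4 : ∫⁻ ξ, ENNReal.ofReal (p.2 ^ ((d : ℝ) + η) * decayKernel d p.2 ‖p.1 - ξ‖) * ‖f ξ‖ₑ
          ∂(sigma d) = ENNReal.ofReal (p.2 ^ ((d : ℝ) + η)) *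
          ∫⁻ ξ, ENNReal.ofReal (decayKernel d p.2 ‖p.1 - ξ‖) * ‖f ξ‖ₑ ∂(sigma d) := by
      rw [← lintegral_const_mul' _ _ ENNReal.ofReal_ne_top]
      refine lintegral_congr fun ξ => ?_
      rw [ENNReal.ofReal_mul (by positivity), mul_assoc]
    rw [h3, h4]
    calc 2 ^ (s : ℝ) * (ENNReal.ofReal (p.2 ^ η) * ENNReal.ofReal (p.2 ^ ((d : ℝ) + η)) *
          ENNReal.ofReal (p.2 ^ (-γ)))
        ≤ 2 ^ (s : ℝ) * (ENNReal.ofReal (δ ^ η) * ENNReal.ofReal (p.2 ^ ((d : ℝ) + η)) *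
          (2 * 3 ^ (d + 1) *
            ∫⁻ ξ, ENNReal.ofReal (decayKernel d p.2 ‖p.1 - ξ‖) * ‖f ξ‖ₑ ∂(sigma d))) := by
          gcongr
      _ = _ := by ring
  refine (Finset.sum_le_sum hterm).trans ?_
  rw [← Finset.mul_sum, ← Finset.mul_sum, mul_assoc _ (packingConst d η)]
  gcongr
  rw [← lintegral_finsetSum' _ fun p _ => ?_, ← lintegral_const_mul' _ _
    (packingConst_lt_top d hη).ne]
  · refine lintegral_mono fun ξ => ?_
    rw [← Finset.sum_mul]
    gcongr
    exact sum_decayKernel_packing_le d hη hη1 (by simp) T' hpack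
  · refine AEMeasurable.mul (Measurable.aemeasurable ?_) hf.enorm
    refine ENNReal.measurable_ofReal.comp (measurable_const.mul ?_)
    exact (measurable_decayKernel d p.2).comp (by fun_prop)

theorem dimP_superLevelSet_le {d : ℕ} {𝕜 : Type*} [RCLike 𝕜] {f : Sph d → 𝕜}
    (hf : Integrable f (sigma d)) {β : ℝ} (hβ : β ≤ d) :
    dimP (superLevelSet f β) ≤ ENNReal.ofReal ((d : ℝ) - β) := by
  refine iSup₂_le fun s hs => ?_
  by_contra! hlt
  rw [← ENNReal.ofReal_coe_nnreal, ENNReal.ofReal_lt_ofReal_iff_of_nonneg (by linarith)] at hlt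
  -- A third of the gap leaves `2η` strictly below it, which is what `γ < β` requires; the `min`
  -- with `1` gives `η ≤ 1`.
  set η : ℝ := min ((s : ℝ) - (d - β)) 1 / 3 with hηdef
  have hη : 0 < η := by
    have : 0 < min ((s : ℝ) - (d - β)) 1 := lt_min (by linarith) one_pos
    positivity
  have hη1 : η ≤ 1 := by have := min_le_right ((s : ℝ) - (d - β)) 1; linarith
  have hη2 : 3 * η ≤ (s : ℝ) - (d - β) := by
    have := min_le_left ((s : ℝ) - (d - β)) 1; linarith
  set γ : ℝ := d + 2 * η - s with hγ
  have hγβ : γ < β := by linarith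
  let F : ℕ → Set (Space d) := fun n => {x | ‖x‖ = 1 ∧ ∀ r : ℝ, 1 - 1 / ((n : ℝ) + 2) ≤ r → r < 1 →
      ENNReal.ofReal ((1 - r) ^ (-γ)) ≤ ‖poissonIntegral f (r • x)‖ₑ}
  have hcover : superLevelSet f β ⊆ ⋃ n, F n := fun x hx => by
    obtain ⟨n, hn⟩ := exists_le_of_mem_superLevelSet hγβ hx
    exact mem_iUnion.2 ⟨n, by simpa using hx.1, hn⟩
  have hzero : ∀ n, packingPre s (F n) = 0 := by
    intro n
    set M : ℝ≥0∞ := 2 ^ (s : ℝ) * (2 * 3 ^ (d + 1)) * packingConst d η *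
      ∫⁻ ξ, ‖f ξ‖ₑ ∂(sigma d) with hM
    have hMfin : M ≠ ∞ := by
      refine ENNReal.mul_ne_top (ENNReal.mul_ne_top (ENNReal.mul_ne_top ?_ ?_)
        (packingConst_lt_top d hη).ne) hf.2.ne
      · simp
      · finiteness
    have hbound : ∀ᶠ δ : ℝ in 𝓝[>] 0, packingPre s (F n) ≤ ENNReal.ofReal (δ ^ η) * M := by
      have hpos : (0 : ℝ) < 1 / ((n : ℝ) + 2) := by positivity
      filter_upwards [Ioo_mem_nhdsGT hpos] with δ hδ
      have hlt1 : 1 / ((n : ℝ) + 2) < 1 := by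
        rw [div_lt_one (by positivity)]; have : (0 : ℝ) ≤ n := by positivity
        linarith
      refine (iInf₂_le δ hδ.1).trans ?_
      exact packingPreDelta_le hf.1.aemeasurable hη hη1 (by linarith) (hδ.2.trans hlt1)
        (fun x hx => by simpa using hx.1) fun x hx r hr => hx.2 r (by linarith [hδ.2])
    have hlim : Tendsto (fun δ : ℝ => ENNReal.ofReal (δ ^ η) * M) (𝓝[>] 0) (𝓝 0) := by
      have h1 : Tendsto (fun δ : ℝ => δ ^ η) (𝓝[>] 0) (𝓝 0) := by
        have := (Real.continuousAt_rpow_const 0 η (Or.inr hη.le)).tendsto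
        rw [Real.zero_rpow hη.ne'] at this
        exact this.mono_left nhdsWithin_le_nhds
      have h2 := ENNReal.Tendsto.mul_const (ENNReal.tendsto_ofReal h1) (Or.inr hMfin)
      simpa using h2
    exact le_antisymm (ge_of_tendsto hlim hbound) (zero_le)
  have : packingMeasure s (superLevelSet f β) = 0 := by
    refine le_antisymm ((iInf₂_le F hcover).trans ?_) (zero_le)
    simp [hzero]
  rw [this] at hs
  exact ENNReal.zero_ne_top hs

end Packing

/-! ### Surface measure of spherical caps -/

section CapMeasure

open scoped Pointwise

variable {d : ℕ}

theorem toSphere_univ_eq (d : ℕ) : (volume : Measure (Space d)).toSphere univ =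
    ((d + 1 : ℕ) : ℝ≥0∞) * volume (Metric.ball (0 : Space d) 1) := by
  rw [Measure.toSphere_apply_univ, finrank_euclideanSpace_fin]

theorem toSphere_univ_ne_zero (d : ℕ) : (volume : Measure (Space d)).toSphere univ ≠ 0 := by
  rw [toSphere_univ_eq]
  exact mul_ne_zero (by simp) (Metric.measure_ball_pos _ _ one_pos).ne'

theorem toSphere_univ_ne_top (d : ℕ) : (volume : Measure (Space d)).toSphere univ ≠ ∞ :=
  measure_ne_top _ _

theorem sigma_apply (s : Set (Sph d)) :
    sigma d s = (volume : Measure (Space d)).toSphere s / (volume : Measure (Space d)).toSphere univ := by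
  rw [sigma, Measure.smul_apply, smul_eq_mul, ENNReal.div_eq_inv_mul]

instance isProbabilityMeasure_sigma (d : ℕ) : IsProbabilityMeasure (sigma d) :=
  ⟨by rw [sigma_apply, ENNReal.div_self (toSphere_univ_ne_zero d) (toSphere_univ_ne_top d)]⟩

/-- The open solid cone over a cap of the sphere. -/
def capCone (z : Sph d) (ρ : ℝ) : Set (Space d) :=
  Ioo (0 : ℝ) 1 • ((↑) '' Metric.closedBall z ρ)

theorem mem_capCone {z : Sph d} {ρ : ℝ} {y : Space d} :
    y ∈ capCone z ρ ↔ ∃ t ∈ Ioo (0 : ℝ) 1, ∃ a : Space d, ‖a‖ = 1 ∧ ‖a - z‖ ≤ ρ ∧ t • a = y := by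
  constructor
  · rintro ⟨t, ht, _, ⟨a, ha, rfl⟩, rfl⟩
    exact ⟨t, ht, a, by simp, by simpa [Subtype.dist_eq, dist_eq_norm] using ha, rfl⟩
  · rintro ⟨t, ht, a, ha, haz, rfl⟩
    exact ⟨t, ht, a, ⟨⟨a, by simpa using ha⟩, by simpa [Subtype.dist_eq, dist_eq_norm] using haz, rfl⟩,
      rfl⟩

theorem norm_lt_one_of_mem_capCone {z : Sph d} {ρ : ℝ} {y : Space d} (hy : y ∈ capCone z ρ) :
    ‖y‖ < 1 := by
  obtain ⟨t, ht, a, ha, -, rfl⟩ := mem_capCone.1 hy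
  rw [norm_smul, ha, mul_one, Real.norm_of_nonneg ht.1.le]
  exact ht.2

theorem volume_capCone_ne_top (z : Sph d) (ρ : ℝ) : volume (capCone z ρ) ≠ ∞ :=
  ne_top_of_le_ne_top (measure_ball_lt_top (μ := volume) (x := (0 : Space d)) (r := 1)).ne
    (measure_mono fun y hy => by simpa using norm_lt_one_of_mem_capCone hy)

theorem volumeReal_smul_capCone (z : Sph d) (ρ : ℝ) {t : ℝ} (ht : 0 ≤ t) :
    volume.real (t • capCone z ρ) = t ^ (d + 1) * volume.real (capCone z ρ) := by
  rw [measureReal_def, Measure.addHaar_smul, finrank_euclideanSpace_fin, ENNReal.toReal_mul,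
    ENNReal.toReal_ofReal (by positivity), abs_of_nonneg (by positivity)]
  rfl

/-- Self-similarity: outside its copy scaled by `1 - ρ`, the cone lies in a ball of radius `2ρ`
about `z`. Subtracting the scaled volume leaves at least `ρ` times the volume of the cone, and
dividing by `ρ` lowers the power from `d + 1` to `d`. -/
theorem volumeReal_capCone_le (z : Sph d) {ρ : ℝ} (hρ : 0 < ρ) (hρ1 : ρ < 1) :
    volume.real (capCone z ρ) ≤
      2 ^ (d + 1) * ρ ^ d * volume.real (Metric.ball (0 : Space d) 1) := by
  have hsub : capCone z ρ ⊆ (1 - ρ) • capCone z ρ ∪ Metric.closedBall (z : Space d) (2 * ρ) := by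
    intro y hy
    obtain ⟨t, ht, a, ha, haz, rfl⟩ := mem_capCone.1 hy
    by_cases h : t < 1 - ρ
    · left
      have h1 : 0 < 1 - ρ := by linarith
      refine mem_smul_set.2 ⟨(t / (1 - ρ)) • a, mem_capCone.2 ⟨_, ⟨by have := ht.1; positivity,
        (div_lt_one h1).2 h⟩, a, ha, haz, rfl⟩, ?_⟩
      rw [smul_smul, mul_div_cancel₀ _ h1.ne']
    · right
      rw [mem_closedBall_iff_norm]
      have : t • a - z = (a - z) - (1 - t) • a := by module
      rw [this]
      refine (norm_sub_le _ _).trans ?_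
      rw [norm_smul, ha, mul_one, Real.norm_of_nonneg (by linarith [ht.2])]
      linarith
  have h1 : volume.real (capCone z ρ) ≤ (1 - ρ) ^ (d + 1) * volume.real (capCone z ρ) +
      (2 * ρ) ^ (d + 1) * volume.real (Metric.ball (0 : Space d) 1) := by
    rw [← volumeReal_smul_capCone z ρ (by linarith : 0 ≤ 1 - ρ)]
    have hb : volume.real (Metric.closedBall (z : Space d) (2 * ρ)) =
        (2 * ρ) ^ (d + 1) * volume.real (Metric.ball (0 : Space d) 1) := by
      rw [Measure.addHaar_real_closedBall _ _ (by positivity), finrank_euclideanSpace_fin]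
    rw [← hb]
    refine (measureReal_mono hsub ?_).trans (measureReal_union_le _ _)
    refine measure_union_ne_top ?_ measure_closedBall_lt_top.ne
    rw [Measure.addHaar_smul]
    exact ENNReal.mul_ne_top ENNReal.ofReal_ne_top (volume_capCone_ne_top z ρ)
  have h2 : (1 - ρ) ^ (d + 1) ≤ 1 - ρ := by
    rw [pow_succ]
    have : (1 - ρ) ^ d ≤ 1 := pow_le_one₀ (by linarith) (by linarith)
    nlinarith
  have h3 : (1 - ρ) ^ (d + 1) * volume.real (capCone z ρ) ≤ (1 - ρ) * volume.real (capCone z ρ) :=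
    mul_le_mul_of_nonneg_right h2 measureReal_nonneg
  have h4 : ρ * volume.real (capCone z ρ) ≤
      ρ * (2 ^ (d + 1) * ρ ^ d * volume.real (Metric.ball (0 : Space d) 1)) := by
    have : ρ * (2 ^ (d + 1) * ρ ^ d * volume.real (Metric.ball (0 : Space d) 1)) =
      (2 * ρ) ^ (d + 1) * volume.real (Metric.ball (0 : Space d) 1) := by ring
    linarith
  exact le_of_mul_le_mul_left h4 hρ

/-- The reverse comparison: the copy scaled by `1 - ρ / 2` and a ball of radius `ρ / 4` are disjoint
inside the cone, and Bernoulli's inequality bounds the volume lost by the scaling. -/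
theorem le_volumeReal_capCone (z : Sph d) {ρ : ℝ} (hρ : 0 < ρ) (hρ1 : ρ ≤ 1) :
    ρ ^ d * volume.real (Metric.ball (0 : Space d) 1) ≤
      (d + 1) * 4 ^ (d + 1) * volume.real (capCone z ρ) := by
  have hz : ‖(z : Space d)‖ = 1 := by simp
  -- This ball touches the sphere at `z` from inside, so its norms fill only `(1 - ρ / 2, 1)`, just
  -- beyond the scaled cone.
  set B : Set (Space d) := Metric.ball ((1 - ρ / 4) • (z : Space d)) (ρ / 4) with hB
  have hnorm : ∀ y ∈ B, 1 - ρ / 2 < ‖y‖ ∧ ‖y‖ < 1 ∧ ‖y - z‖ < ρ / 2 := by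
    intro y hy
    rw [hB, mem_ball_iff_norm] at hy
    have h0 : ‖(1 - ρ / 4) • (z : Space d)‖ = 1 - ρ / 4 := by
      rw [norm_smul, hz, mul_one, Real.norm_of_nonneg (by linarith)]
    have h1 := norm_sub_norm_le ((1 - ρ / 4) • (z : Space d)) y
    have h2 := norm_sub_norm_le y ((1 - ρ / 4) • (z : Space d))
    rw [norm_sub_rev] at h1
    refine ⟨by linarith, by linarith, ?_⟩
    have h3 : y - z = (y - (1 - ρ / 4) • (z : Space d)) - (ρ / 4) • (z : Space d) := by module
    rw [h3]
    refine (norm_sub_le _ _).trans_lt ?_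
    rw [norm_smul, hz, mul_one, Real.norm_of_nonneg (by linarith)]
    linarith
  have hdisj : Disjoint ((1 - ρ / 2) • capCone z ρ) B := by
    rw [Set.disjoint_left]
    intro y hy hyB
    obtain ⟨w, hw, rfl⟩ := mem_smul_set.1 hy
    have h1 := (hnorm _ hyB).1
    rw [norm_smul, Real.norm_of_nonneg (by linarith)] at h1
    have := norm_lt_one_of_mem_capCone hw
    nlinarith
  have hsub : (1 - ρ / 2) • capCone z ρ ∪ B ⊆ capCone z ρ := by
    rintro y (hy | hy)
    · obtain ⟨w, hw, rfl⟩ := mem_smul_set.1 hy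
      obtain ⟨t, ht, a, ha, haz, rfl⟩ := mem_capCone.1 hw
      refine mem_capCone.2 ⟨(1 - ρ / 2) * t, ⟨mul_pos (by linarith) ht.1, ?_⟩, a, ha, haz, ?_⟩
      · nlinarith [ht.1, ht.2]
      · rw [smul_smul]
    · obtain ⟨h1, h2, h3⟩ := hnorm y hy
      have hpos : 0 < ‖y‖ := by linarith
      refine mem_capCone.2 ⟨‖y‖, ⟨hpos, h2⟩, ‖y‖⁻¹ • y, ?_, ?_, ?_⟩
      · rw [norm_smul, norm_inv, norm_norm, inv_mul_cancel₀ hpos.ne']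
      · have h4 : ‖y‖⁻¹ • y - z = (y - z) + (1 - ‖y‖) • (‖y‖⁻¹ • y) := by
          rw [sub_smul, one_smul, smul_smul, mul_inv_cancel₀ hpos.ne', one_smul]
          abel
        rw [h4]
        refine (norm_add_le _ _).trans ?_
        have : ‖‖y‖⁻¹ • y‖ = 1 := by rw [norm_smul, norm_inv, norm_norm, inv_mul_cancel₀ hpos.ne']
        rw [norm_smul, this, mul_one, Real.norm_of_nonneg (by linarith)]
        linarith
      · rw [smul_smul, mul_inv_cancel₀ hpos.ne', one_smul]
  have hfin : volume ((1 - ρ / 2) • capCone z ρ) ≠ ∞ := by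
    rw [Measure.addHaar_smul]
    exact ENNReal.mul_ne_top ENNReal.ofReal_ne_top (volume_capCone_ne_top z ρ)
  have h1 : (1 - ρ / 2) ^ (d + 1) * volume.real (capCone z ρ) +
      (ρ / 4) ^ (d + 1) * volume.real (Metric.ball (0 : Space d) 1) ≤
      volume.real (capCone z ρ) := by
    have hb : volume.real B = (ρ / 4) ^ (d + 1) * volume.real (Metric.ball (0 : Space d) 1) := by
      rw [hB, measureReal_def, Measure.addHaar_ball _ _ (by positivity), finrank_euclideanSpace_fin,
        ENNReal.toReal_mul, ENNReal.toReal_ofReal (by positivity), measureReal_def]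
    rw [← hb, ← volumeReal_smul_capCone z ρ (by linarith : 0 ≤ 1 - ρ / 2),
      ← measureReal_union hdisj measurableSet_ball hfin measure_ball_lt_top.ne]
    exact measureReal_mono hsub (volume_capCone_ne_top z ρ)
  have h2 : 1 - (d + 1) * (ρ / 2) ≤ (1 - ρ / 2) ^ (d + 1) := by
    have := one_add_mul_le_pow (a := -(ρ / 2)) (by linarith) (d + 1)
    push_cast at this
    calc _ = 1 + ((d : ℝ) + 1) * -(ρ / 2) := by ring
      _ ≤ _ := this
      _ = _ := by ring
  have hV : 0 ≤ volume.real (capCone z ρ) := measureReal_nonneg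
  have h3 := mul_le_mul_of_nonneg_right h2 hV
  have h4 : (ρ / 4) ^ (d + 1) * volume.real (Metric.ball (0 : Space d) 1) ≤
      (d + 1) * (ρ / 2) * volume.real (capCone z ρ) := by linarith
  have h5 : (ρ / 4) ^ (d + 1) * 4 ^ (d + 1) = ρ ^ d * ρ := by
    rw [← mul_pow, div_mul_cancel₀ _ (by norm_num), pow_succ]
  have h6 : ρ * (ρ ^ d * volume.real (Metric.ball (0 : Space d) 1)) ≤
      ρ * ((d + 1) * 4 ^ (d + 1) * volume.real (capCone z ρ)) := by
    calc ρ * (ρ ^ d * volume.real (Metric.ball (0 : Space d) 1))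
        = 4 ^ (d + 1) * ((ρ / 4) ^ (d + 1) * volume.real (Metric.ball (0 : Space d) 1)) := by
          rw [← mul_assoc, mul_comm ρ, ← h5]; ring
      _ ≤ 4 ^ (d + 1) * ((d + 1) * (ρ / 2) * volume.real (capCone z ρ)) := by gcongr
      _ ≤ 4 ^ (d + 1) * ((d + 1) * ρ * volume.real (capCone z ρ)) := by gcongr; linarith
      _ = _ := by ring
  exact le_of_mul_le_mul_left h6 hρ

theorem sigma_closedBall_eq (z : Sph d) (ρ : ℝ) : sigma d (Metric.closedBall z ρ) =
    ENNReal.ofReal (volume.real (capCone z ρ) / volume.real (Metric.ball (0 : Space d) 1)) := by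
  have hv : 0 < volume.real (Metric.ball (0 : Space d) 1) :=
    ENNReal.toReal_pos (Metric.measure_ball_pos _ _ one_pos).ne' measure_ball_lt_top.ne
  rw [sigma_apply, toSphere_univ_eq, Measure.toSphere_apply' _ Metric.isClosed_closedBall.measurableSet,
    finrank_euclideanSpace_fin, ENNReal.mul_div_mul_left _ _ (by simp) (by simp),
    ENNReal.ofReal_div_of_pos hv, ofReal_measureReal (volume_capCone_ne_top z ρ), ofReal_measureReal,
    capCone]

theorem sigma_closedBall_le (z : Sph d) {ρ : ℝ} (hρ : 0 < ρ) :
    sigma d (Metric.closedBall z ρ) ≤ ENNReal.ofReal (2 ^ (d + 1) * ρ ^ d) := by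
  have hv : 0 < volume.real (Metric.ball (0 : Space d) 1) :=
    ENNReal.toReal_pos (Metric.measure_ball_pos _ _ one_pos).ne' measure_ball_lt_top.ne
  rcases lt_or_ge ρ 1 with h | h
  · rw [sigma_closedBall_eq]
    refine ENNReal.ofReal_le_ofReal ?_
    rw [div_le_iff₀ hv]
    exact volumeReal_capCone_le z hρ h
  · refine prob_le_one.trans ?_
    rw [← ENNReal.ofReal_one]
    refine ENNReal.ofReal_le_ofReal ?_
    have h1 : (1 : ℝ) ≤ 2 ^ (d + 1) := one_le_pow₀ (by norm_num)
    have h2 : 1 ≤ ρ ^ d := one_le_pow₀ h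
    nlinarith

theorem le_sigma_closedBall (z : Sph d) {ρ : ℝ} (hρ : 0 < ρ) (hρ1 : ρ ≤ 1) :
    ENNReal.ofReal (ρ ^ d / ((d + 1) * 4 ^ (d + 1))) ≤ sigma d (Metric.closedBall z ρ) := by
  have hv : 0 < volume.real (Metric.ball (0 : Space d) 1) :=
    ENNReal.toReal_pos (Metric.measure_ball_pos _ _ one_pos).ne' measure_ball_lt_top.ne
  rw [sigma_closedBall_eq]
  refine ENNReal.ofReal_le_ofReal ?_
  rw [div_le_div_iff₀ (by positivity) hv]
  exact (le_volumeReal_capCone z hρ hρ1).trans (le_of_eq (by ring))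

end CapMeasure

/-! ### Equidistributed levels of binary positions -/

section Levels

/-- The level of the binary position `k`: its relative place in the block
`[j², (j+1)²)` that contains it. -/
noncomputable def level (k : ℕ) : ℝ := ((k - k.sqrt * k.sqrt : ℕ) : ℝ) / (2 * k.sqrt + 1)

/-- The number of positions below `n` whose level is at least `t`. -/
noncomputable def freeCount (t : ℝ) (n : ℕ) : ℕ := ∑ k ∈ Finset.range n, if t ≤ level k then 1 else 0

theorem freeCount_mono (t : ℝ) {m n : ℕ} (h : m ≤ n) : freeCount t m ≤ freeCount t n :=
  Finset.sum_le_sum_of_subset (Finset.range_mono h)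

theorem level_block (j : ℕ) {i : ℕ} (hi : i < 2 * j + 1) :
    level (j * j + i) = (i : ℝ) / (2 * j + 1) := by
  have h : (j * j + i).sqrt = j := Nat.sqrt_add_eq j (by omega)
  rw [level, h]
  simp

theorem freeCount_block (t : ℝ) (j : ℕ) :
    freeCount t ((j + 1) * (j + 1)) = freeCount t (j * j) + (2 * j + 1 - ⌈t * (2 * j + 1)⌉₊) := by
  have h : (j + 1) * (j + 1) = j * j + (2 * j + 1) := by ring
  rw [h, freeCount, Finset.sum_range_add, ← freeCount]
  congr 1
  rw [← Finset.card_filter, ← Nat.card_Ico]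
  congr 1
  ext i
  simp only [Finset.mem_filter, Finset.mem_range, Finset.mem_Ico, Nat.ceil_le]
  rw [and_comm]
  refine and_congr_left fun hi => ?_
  rw [level_block j hi, le_div_iff₀ (by positivity)]

/-- The block starting at `j²` carries the levels `i / (2j + 1)`, so it contributes `(1 - t)(2j +
1)` up to a one-sided rounding error less than `1`; after `j` blocks the error is at most `j`. -/
theorem freeCount_sq (t : ℝ) (ht0 : 0 ≤ t) (ht1 : t ≤ 1) (j : ℕ) :
    (1 - t) * (j * j : ℕ) - j ≤ freeCount t (j * j) ∧
      (freeCount t (j * j) : ℝ) ≤ (1 - t) * (j * j : ℕ) := by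
  induction j with
  | zero => simp [freeCount]
  | succ j ih =>
    rw [freeCount_block t]
    have hM : (0 : ℝ) < 2 * j + 1 := by positivity
    have hle : ⌈t * (2 * (j : ℝ) + 1)⌉₊ ≤ 2 * j + 1 := by
      rw [Nat.ceil_le]; push_cast; nlinarith
    have h1 := Nat.le_ceil (t * (2 * (j : ℝ) + 1))
    have h2 := Nat.ceil_lt_add_one (a := t * (2 * (j : ℝ) + 1)) (by positivity)
    rw [Nat.cast_add (freeCount t (j * j)), Nat.cast_sub hle]
    push_cast at ih ⊢
    constructor <;> nlinarith [ih.1, ih.2]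

/-- By monotonicity `n` can be compared with the two neighbouring squares; the incomplete block
costs only `O(√n)`. -/
theorem freeCount_bounds (t : ℝ) (ht0 : 0 ≤ t) (ht1 : t ≤ 1) (n : ℕ) :
    (1 - t) * n - (3 * √n + 1) ≤ freeCount t n ∧
      (freeCount t n : ℝ) ≤ (1 - t) * n + (3 * √n + 1) := by
  set j := n.sqrt with hj
  have h1 : j * j ≤ n := Nat.sqrt_le n
  have h2 : n ≤ j * j + j + j := Nat.sqrt_le_add n
  have h3 : n ≤ (j + 1) * (j + 1) := by nlinarith
  have hjs : (j : ℝ) ≤ √n := Real.le_sqrt_of_sq_le (by rw [sq]; exact_mod_cast h1)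
  have a1 := (freeCount_sq t ht0 ht1 j).1
  have a2 := (freeCount_sq t ht0 ht1 (j + 1)).2
  have a3 : (freeCount t (j * j) : ℝ) ≤ freeCount t n := by exact_mod_cast freeCount_mono t h1
  have a4 : (freeCount t n : ℝ) ≤ freeCount t ((j + 1) * (j + 1)) := by
    exact_mod_cast freeCount_mono t h3
  have h1' : (j * j : ℝ) ≤ n := by exact_mod_cast h1
  have h2' : (n : ℝ) ≤ j * j + j + j := by exact_mod_cast h2
  push_cast at a1 a2
  have hj0 : (0 : ℝ) ≤ j := by positivity
  constructor <;> nlinarith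

end Levels

/-! ### Binary prefixes and masked digits -/

section Digits

/-- The binary prefix of length `n`, as a natural number. -/
def binaryPrefix (e : ℕ → Fin 2) : ℕ → ℕ
  | 0 => 0
  | n + 1 => 2 * binaryPrefix e n + (e n : ℕ)

theorem eq_of_binaryPrefix_eq {e e' : ℕ → Fin 2} {n : ℕ}
    (h : binaryPrefix e n = binaryPrefix e' n) : ∀ k < n, e k = e' k := by
  induction n with
  | zero => simp
  | succ n ih =>
    simp only [binaryPrefix] at h
    have h1 := (e n).isLt
    have h2 := (e' n).isLt
    intro k hk
    rcases Nat.lt_succ_iff_lt_or_eq.1 hk with hk | rfl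
    · exact ih (by omega) k hk
    · exact Fin.ext (by omega)

theorem sum_ofDigitsTerm_eq (e : ℕ → Fin 2) (n : ℕ) :
    ∑ i ∈ Finset.range n, Real.ofDigitsTerm e i = binaryPrefix e n * ((2 : ℝ) ^ n)⁻¹ := by
  induction n with
  | zero => simp [binaryPrefix]
  | succ n ih =>
    rw [Finset.sum_range_succ, ih, Real.ofDigitsTerm, binaryPrefix]
    push_cast
    rw [pow_succ]
    field_simp

theorem binaryPrefix_bounds (e : ℕ → Fin 2) (n : ℕ) :
    (binaryPrefix e n : ℝ) ≤ 2 ^ n * Real.ofDigits e ∧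
      2 ^ n * Real.ofDigits e ≤ binaryPrefix e n + 1 := by
  have h0 := Real.ofDigits_nonneg (fun i => e (i + n))
  have h1 := Real.ofDigits_le_one (fun i => e (i + n))
  have h2 : 2 ^ n * Real.ofDigits e = binaryPrefix e n + Real.ofDigits (fun i => e (i + n)) := by
    rw [Real.ofDigits_eq_sum_add_ofDigits e n, sum_ofDigitsTerm_eq]
    push_cast
    field_simp
  constructor <;> linarith

/-- The sequence `e` with all digits at positions of level less than `t` replaced by `0`. -/
noncomputable def maskDigits (t : ℝ) (e : ℕ → Fin 2) (k : ℕ) : Fin 2 :=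
  if level k < t then 0 else e k

end Digits

/-! ### Random points of the cube -/

section Coins

variable {d : ℕ}

/-- The fair measure on `{0, 1}`. -/
noncomputable def fairCoin : Measure (Fin 2) := (PMF.uniformOfFintype (Fin 2)).toMeasure

instance : IsProbabilityMeasure fairCoin := by unfold fairCoin; infer_instance

theorem fairCoin_singleton (a : Fin 2) : fairCoin {a} = 2⁻¹ := by
  rw [fairCoin, PMF.toMeasure_apply_singleton _ _ (measurableSet_singleton a)]
  simp

/-- Independent fair digits. -/
noncomputable def coins (d : ℕ) : Measure (ℕ × Fin d → Fin 2) :=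
  Measure.infinitePi fun _ => fairCoin

instance : IsProbabilityMeasure (coins d) := by unfold coins; infer_instance

theorem coins_cylinder (J : Finset (ℕ × Fin d)) (ω₀ : ℕ × Fin d → Fin 2) :
    coins d {ω | ∀ p ∈ J, ω p = ω₀ p} = 2⁻¹ ^ J.card := by
  have h : {ω : ℕ × Fin d → Fin 2 | ∀ p ∈ J, ω p = ω₀ p} = Set.pi J fun p => {ω₀ p} := by
    ext ω; simp
  rw [h, coins, Measure.infinitePi_pi _ fun p _ => measurableSet_singleton _]
  simp [fairCoin_singleton]

/-- The free positions below `n` in all coordinates. -/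
noncomputable def freePositions (d : ℕ) (t : ℝ) (n : ℕ) : Finset (ℕ × Fin d) :=
  ((Finset.range n).filter fun k => t ≤ level k) ×ˢ Finset.univ

theorem card_freePositions (t : ℝ) (n : ℕ) :
    (freePositions d t n).card = freeCount t n * d := by
  rw [freePositions, Finset.card_product, Finset.card_filter, Finset.card_univ, Fintype.card_fin]
  rfl

/-- The masked digits of the `i`-th coordinate. -/
noncomputable def coordDigits (t : ℝ) (ω : ℕ × Fin d → Fin 2) (i : Fin d) : ℕ → Fin 2 :=
  maskDigits t fun k => ω (k, i)

/-- The point of the cube with the masked digits. -/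
noncomputable def cubePoint (t : ℝ) (ω : ℕ × Fin d → Fin 2) (i : Fin d) : ℝ :=
  Real.ofDigits (coordDigits t ω i)

theorem cubePoint_mem (t : ℝ) (ω : ℕ × Fin d → Fin 2) (i : Fin d) :
    cubePoint t ω i ∈ Icc (0 : ℝ) 1 :=
  ⟨Real.ofDigits_nonneg _, Real.ofDigits_le_one _⟩

theorem measurable_cubePoint (t : ℝ) (i : Fin d) :
    Measurable fun ω : ℕ × Fin d → Fin 2 => cubePoint t ω i := by
  refine Real.continuous_ofDigits.measurable.comp (measurable_pi_lambda _ fun k => ?_)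
  unfold coordDigits maskDigits
  split_ifs
  · exact measurable_const
  · exact measurable_pi_apply _

/-- If the digits at the free positions of `t'` agree with the masked digits for `t ≥ t'`, the two
points of the cube are close. -/
theorem abs_cubePoint_sub_le {t t' : ℝ} (htt : t' ≤ t) {n : ℕ} {ω ω' : ℕ × Fin d → Fin 2}
    (h : ∀ p ∈ freePositions d t' n, ω' p = coordDigits t ω p.2 p.1) (i : Fin d) :
    |cubePoint t' ω' i - cubePoint t ω i| ≤ (2⁻¹ : ℝ) ^ n := by
  rw [inv_pow]
  refine Real.abs_ofDigits_sub_ofDigits_le (b := 2) fun k hk => ?_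
  rw [coordDigits, maskDigits]
  split_ifs with hk'
  · rw [coordDigits, maskDigits, if_pos (hk'.trans_le htt)]
  · exact h (k, i) (by simpa [freePositions, hk] using hk')

/-- Closeness to `c` leaves four possible prefixes of length `n` per coordinate, and a choice of
prefixes fixes all free digits below `n`, hence lies in a cylinder of known measure. -/
theorem coins_cubePoint_le (t : ℝ) (n : ℕ) (c : Fin d → ℝ) :
    coins d {ω | ∀ i, |cubePoint t ω i - c i| ≤ (2⁻¹ : ℝ) ^ n} ≤
      4 ^ d * 2⁻¹ ^ (freeCount t n * d) := by
  -- The prefix lies between `2^n x - 1` and `2^n x`, hence between `2^n c - 2` and `2^n c + 1`: the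
  -- integers from `m` to `m + 3`.
  let m : Fin d → ℤ := fun i => ⌈2 ^ n * c i⌉ - 2
  let B : (Fin d → Fin 4) → Set (ℕ × Fin d → Fin 2) := fun v =>
    {ω | ∀ i, (binaryPrefix (coordDigits t ω i) n : ℤ) = m i + (v i : ℕ)}
  have hcov : {ω : ℕ × Fin d → Fin 2 | ∀ i, |cubePoint t ω i - c i| ≤ (2⁻¹ : ℝ) ^ n} ⊆
      ⋃ v ∈ (Finset.univ : Finset (Fin d → Fin 4)), B v := by
    intro ω hω
    have key : ∀ i, ∃ v : Fin 4, (binaryPrefix (coordDigits t ω i) n : ℤ) = m i + (v : ℕ) := by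
      intro i
      obtain ⟨h1, h2⟩ := binaryPrefix_bounds (coordDigits t ω i) n
      have h3 := abs_le.1 (hω i)
      have hp : (0 : ℝ) < 2 ^ n := by positivity
      have h4 : (2 : ℝ) ^ n * (2⁻¹ : ℝ) ^ n = 1 := by rw [← mul_pow]; norm_num
      have h5 : 2 ^ n * cubePoint t ω i ≤ 2 ^ n * c i + 1 := by nlinarith [h3.2]
      have h6 : 2 ^ n * c i - 1 ≤ 2 ^ n * cubePoint t ω i := by nlinarith [h3.1]
      rw [cubePoint] at h5 h6
      have h7 := Int.le_ceil (2 ^ n * c i)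
      have h8 := Int.ceil_lt_add_one (2 ^ n * c i)
      have lo : m i ≤ (binaryPrefix (coordDigits t ω i) n : ℤ) := by
        have : ((m i : ℤ) : ℝ) < ((binaryPrefix (coordDigits t ω i) n : ℤ) : ℝ) + 1 := by
          simp only [m]; push_cast; linarith
        have : m i < (binaryPrefix (coordDigits t ω i) n : ℤ) + 1 := by exact_mod_cast this
        omega
      have hi : (binaryPrefix (coordDigits t ω i) n : ℤ) ≤ m i + 3 := by
        have : ((binaryPrefix (coordDigits t ω i) n : ℤ) : ℝ) ≤ ((m i + 3 : ℤ) : ℝ) := by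
          simp only [m]; push_cast; linarith
        exact_mod_cast this
      refine ⟨⟨((binaryPrefix (coordDigits t ω i) n : ℤ) - m i).toNat, by omega⟩, ?_⟩
      simp only
      omega
    choose v hv using key
    exact mem_iUnion₂.2 ⟨v, Finset.mem_univ _, hv⟩
  have hB : ∀ v, coins d (B v) ≤ 2⁻¹ ^ (freeCount t n * d) := by
    intro v
    rcases (B v).eq_empty_or_nonempty with h | ⟨ω₀, h₀⟩
    · rw [h, measure_empty]; exact zero_le
    · rw [← card_freePositions, ← coins_cylinder _ ω₀]
      refine measure_mono fun ω hω p hp => ?_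
      obtain ⟨hp1, hp2⟩ : p.1 < n ∧ t ≤ level p.1 := by simpa [freePositions] using hp
      have h1 : binaryPrefix (coordDigits t ω p.2) n = binaryPrefix (coordDigits t ω₀ p.2) n := by
        have := (hω p.2).trans (h₀ p.2).symm
        exact_mod_cast this
      have h2 := eq_of_binaryPrefix_eq h1 p.1 hp1
      simpa [coordDigits, maskDigits, not_lt.2 hp2] using h2
  calc coins d {ω | ∀ i, |cubePoint t ω i - c i| ≤ (2⁻¹ : ℝ) ^ n}
      ≤ coins d (⋃ v ∈ (Finset.univ : Finset (Fin d → Fin 4)), B v) := measure_mono hcov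
    _ ≤ ∑ v : Fin d → Fin 4, coins d (B v) := measure_biUnion_finset_le _ _
    _ ≤ ∑ _v : Fin d → Fin 4, 2⁻¹ ^ (freeCount t n * d) := Finset.sum_le_sum fun v _ => hB v
    _ = _ := by simp

end Coins

/-! ### Transfer to the sphere -/

section Chart

variable {d : ℕ}

/-- A chart of the sphere near a pole, over the unit cube. -/
noncomputable def cap (x : Fin d → ℝ) : Space d :=
  WithLp.toLp 2 (Fin.cons √(1 - ∑ i, (x i / (d + 1)) ^ 2) fun i => x i / (d + 1))

theorem cap_succ (x : Fin d → ℝ) (i : Fin d) : cap x i.succ = x i / (d + 1) := rfl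

theorem cap_zero (x : Fin d → ℝ) : cap x 0 = √(1 - ∑ i, (x i / (d + 1)) ^ 2) := rfl

/-- The division by `d + 1` in the chart serves this bound: the square root defining the zeroth
coordinate stays away from its singularity, so the chart is Lipschitz. -/
theorem sum_sq_le {x : Fin d → ℝ} (hx : ∀ i, x i ∈ Icc (0 : ℝ) 1) :
    ∑ i, (x i / (d + 1)) ^ 2 ≤ 1 / 4 := by
  have hd : (0 : ℝ) < d + 1 := by positivity
  calc ∑ i, (x i / (d + 1)) ^ 2 ≤ ∑ _i : Fin d, (1 / ((d : ℝ) + 1)) ^ 2 := by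
        refine Finset.sum_le_sum fun i _ => ?_
        have := hx i
        exact pow_le_pow_left₀ (div_nonneg this.1 hd.le) (by gcongr; exact this.2) 2
    _ = d / ((d : ℝ) + 1) ^ 2 := by simp; ring
    _ ≤ 1 / 4 := by
        rw [div_le_div_iff₀ (by positivity) (by norm_num)]
        nlinarith [sq_nonneg ((d : ℝ) - 1)]

theorem norm_cap {x : Fin d → ℝ} (hx : ∀ i, x i ∈ Icc (0 : ℝ) 1) : ‖cap x‖ = 1 := by
  rw [EuclideanSpace.norm_eq, Real.sqrt_eq_one, Fin.sum_univ_succ]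
  simp only [cap_zero, cap_succ, Real.norm_eq_abs, sq_abs]
  rw [Real.sq_sqrt (by have := sum_sq_le hx; linarith)]
  ring

theorem norm_le_of_coord_le {v : Space d} {ε : ℝ} (hε : 0 ≤ ε) (h : ∀ i, |v i| ≤ ε) :
    ‖v‖ ≤ (d + 1) * ε := by
  rw [EuclideanSpace.norm_eq]
  refine Real.sqrt_le_iff.2 ⟨by positivity, ?_⟩
  calc ∑ i, ‖v i‖ ^ 2 ≤ ∑ _i : Fin (d + 1), ε ^ 2 :=
        Finset.sum_le_sum fun i _ => pow_le_pow_left₀ (norm_nonneg _) (h i) 2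
    _ = (d + 1) * ε ^ 2 := by simp
    _ ≤ ((d + 1) * ε) ^ 2 := by
        rw [mul_pow]
        have : (d : ℝ) + 1 ≤ ((d : ℝ) + 1) ^ 2 := by
          have : (0 : ℝ) ≤ d := by positivity
          nlinarith
        exact mul_le_mul_of_nonneg_right this (sq_nonneg ε)

theorem abs_coord_le (v : Space d) (i : Fin (d + 1)) : |v i| ≤ ‖v‖ := by
  simpa using PiLp.norm_apply_le v i

theorem norm_cap_sub_le {x y : Fin d → ℝ} (hx : ∀ i, x i ∈ Icc (0 : ℝ) 1)
    (hy : ∀ i, y i ∈ Icc (0 : ℝ) 1) {ε : ℝ} (hε : 0 ≤ ε) (h : ∀ i, |x i - y i| ≤ ε) :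
    ‖cap x - cap y‖ ≤ (d + 1) * (2 * ε) := by
  have hd : (0 : ℝ) < d + 1 := by positivity
  refine norm_le_of_coord_le (by positivity) fun i => ?_
  have hsub : (cap x - cap y) i = cap x i - cap y i := rfl
  rw [hsub]
  refine Fin.cases ?_ (fun i => ?_) i
  · rw [cap_zero, cap_zero]
    set p := ∑ i, (x i / (d + 1)) ^ 2
    set q := ∑ i, (y i / (d + 1)) ^ 2
    have hp : p ≤ 1 / 4 := sum_sq_le hx
    have hq : q ≤ 1 / 4 := sum_sq_le hy
    have hp' : 1 / 2 ≤ √(1 - p) := Real.le_sqrt_of_sq_le (by linarith)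
    have hq' : 1 / 2 ≤ √(1 - q) := Real.le_sqrt_of_sq_le (by linarith)
    have e : (√(1 - p) - √(1 - q)) * (√(1 - p) + √(1 - q)) = q - p := by
      ring_nf
      rw [Real.sq_sqrt (by linarith), Real.sq_sqrt (by linarith)]
      ring
    -- Both roots are at least `1/2`, so the second factor in `e` is at least `1`.
    have hle : |√(1 - p) - √(1 - q)| ≤ |q - p| := by
      rw [← e, abs_mul]
      refine le_mul_of_one_le_right (abs_nonneg _) ?_
      rw [abs_of_nonneg (by linarith)]
      linarith
    refine hle.trans ?_
    have : q - p = ∑ i, ((y i / (d + 1)) ^ 2 - (x i / (d + 1)) ^ 2) := by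
      rw [Finset.sum_sub_distrib]
    rw [this]
    refine (Finset.abs_sum_le_sum_abs _ _).trans ?_
    calc ∑ i, |(y i / (d + 1)) ^ 2 - (x i / (d + 1)) ^ 2|
        ≤ ∑ _i : Fin d, 2 * ε / ((d : ℝ) + 1) ^ 2 := by
          refine Finset.sum_le_sum fun i _ => ?_
          have : (y i / ((d : ℝ) + 1)) ^ 2 - (x i / (d + 1)) ^ 2 =
              -((x i - y i) * (x i + y i) / (d + 1) ^ 2) := by
            rw [div_pow, div_pow]; ring
          rw [this, abs_neg, abs_div, abs_mul, abs_of_nonneg (by positivity : 0 ≤ ((d : ℝ) + 1) ^ 2)]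
          refine div_le_div_of_nonneg_right ?_ (by positivity)
          have h1 : |x i + y i| ≤ 2 := by
            rw [abs_of_nonneg (add_nonneg (hx i).1 (hy i).1)]
            linarith [(hx i).2, (hy i).2]
          calc |x i - y i| * |x i + y i| ≤ ε * 2 := mul_le_mul (h i) h1 (abs_nonneg _) hε
            _ = 2 * ε := by ring
      _ = d / ((d : ℝ) + 1) ^ 2 * (2 * ε) := by simp; ring
      _ ≤ 1 * (2 * ε) := by
          gcongr
          rw [div_le_one (by positivity)]
          nlinarith [(by positivity : (0 : ℝ) ≤ d)]
      _ = 2 * ε := one_mul _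
  · rw [cap_succ, cap_succ, ← sub_div, abs_div, abs_of_pos hd]
    refine (div_le_self (abs_nonneg _) (by have : (0 : ℝ) ≤ d := by positivity
                                           linarith)).trans ?_
    linarith [h i]

/-- The point of the sphere with the masked digits. -/
noncomputable def spherePoint (t : ℝ) (ω : ℕ × Fin d → Fin 2) : Sph d :=
  ⟨cap (cubePoint t ω), by simpa using norm_cap (cubePoint_mem t ω)⟩

theorem coe_spherePoint (t : ℝ) (ω : ℕ × Fin d → Fin 2) :
    (spherePoint t ω : Space d) = cap (cubePoint t ω) := rfl

theorem measurable_spherePoint (t : ℝ) :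
    Measurable fun ω : ℕ × Fin d → Fin 2 => spherePoint t ω := by
  refine Measurable.subtype_mk ?_
  refine (WithLp.measurable_toLp 2 _).comp (measurable_pi_lambda _ fun i => ?_)
  have := measurable_cubePoint (d := d) t
  refine Fin.cases ?_ (fun i => ?_) i
  · simp only [Fin.cons_zero]
    fun_prop
  · simp only [Fin.cons_succ]
    fun_prop

theorem dist_spherePoint_le {t t' : ℝ} (htt : t' ≤ t) {n : ℕ} {ω ω' : ℕ × Fin d → Fin 2}
    (h : ∀ p ∈ freePositions d t' n, ω' p = coordDigits t ω p.2 p.1) :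
    dist (spherePoint t' ω') (spherePoint t ω) ≤ 2 * (d + 1) * (2⁻¹ : ℝ) ^ n := by
  rw [Subtype.dist_eq, dist_eq_norm, coe_spherePoint, coe_spherePoint]
  refine (norm_cap_sub_le (cubePoint_mem _ _) (cubePoint_mem _ _) (by positivity)
    (abs_cubePoint_sub_le htt h)).trans (le_of_eq (by ring))

/-- The last `d` coordinates of the chart recover the cube point up to the factor `d + 1`. -/
theorem coins_spherePoint_le (t : ℝ) (n : ℕ) (z : Space d) {ρ : ℝ}
    (hρ : (d + 1) * ρ ≤ (2⁻¹ : ℝ) ^ n) :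
    coins d {ω | ‖(spherePoint t ω : Space d) - z‖ ≤ ρ} ≤ 4 ^ d * 2⁻¹ ^ (freeCount t n * d) := by
  refine (measure_mono fun ω hω i => ?_).trans
    (coins_cubePoint_le t n fun i => (d + 1) * z i.succ)
  have hd : (0 : ℝ) < d + 1 := by positivity
  have h1 := (abs_coord_le ((spherePoint t ω : Space d) - z) i.succ).trans hω
  have h2 : ((spherePoint t ω : Space d) - z) i.succ = cubePoint t ω i / (d + 1) - z i.succ := rfl
  rw [h2] at h1
  have h3 : cubePoint t ω i - (d + 1) * z i.succ =
      (d + 1) * (cubePoint t ω i / (d + 1) - z i.succ) := by field_simp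
  rw [h3, abs_mul, abs_of_pos hd]
  exact (mul_le_mul_of_nonneg_left h1 hd.le).trans hρ

end Chart

/-! ### Frostman estimates, potentials and the Hausdorff lower bound -/

variable {d : ℕ}

/-- Absorbs the `√n` errors of the digit counts into an arbitrarily small linear term. -/
theorem mul_sqrt_le {κ : ℝ} (hκ : 0 < κ) (a : ℝ) (n : ℕ) : a * √n ≤ κ * n + a ^ 2 / (4 * κ) := by
  have h : √(n : ℝ) ^ 2 = n := Real.sq_sqrt (by positivity)
  have h2 : κ * n + a ^ 2 / (4 * κ) - a * √n = (2 * κ * √n - a) ^ 2 / (4 * κ) := by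
    field_simp
    rw [← h, Real.sqrt_sq (Real.sqrt_nonneg _)]
    ring
  have h3 : 0 ≤ (2 * κ * √n - a) ^ 2 / (4 * κ) := by positivity
  linarith

theorem inv_two_pow_eq_rpow (m : ℕ) : (2⁻¹ : ℝ) ^ m = 2 ^ (-(m : ℝ)) := by
  rw [Real.rpow_neg (by norm_num), Real.rpow_natCast, inv_pow]

/-- Frostman estimate for the law of `spherePoint`. -/
theorem exists_coins_spherePoint_le {t : ℝ} (ht0 : 0 ≤ t) (ht1 : t ≤ 1) {s : ℝ} (hs0 : 0 ≤ s)
    (hs : s = 0 ∨ s < d * (1 - t)) :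
    ∃ C : ℝ, 0 < C ∧ ∀ (z : Space d) (ρ : ℝ), 0 < ρ →
      coins d {ω | ‖(spherePoint t ω : Space d) - z‖ ≤ ρ} ≤ ENNReal.ofReal (C * ρ ^ s) := by
  rcases hs with rfl | hs
  · exact ⟨1, one_pos, fun z ρ hρ => by simpa using prob_le_one⟩
  set κ : ℝ := d * (1 - t) - s with hκdef
  have hκ : 0 < κ := by linarith
  -- The constant collects the `+ 1` of `freeCount_bounds` times `d`, the shift from `n` to `n + 1`
  -- times `s`, and what remains after `κ n` absorbs `3 d √n`.
  set a : ℝ := d + s + (3 * d) ^ 2 / (4 * κ) with ha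
  have ha0 : 0 ≤ a := by positivity
  have hd : (0 : ℝ) < d + 1 := by positivity
  refine ⟨4 ^ d * 2 ^ a * (d + 1) ^ s, by positivity, fun z ρ hρ => ?_⟩
  rcases le_or_gt ((d + 1) * ρ) 1 with h1 | h1
  · obtain ⟨n, hn1, hn2⟩ := exists_nat_pow_near_of_lt_one (by positivity : 0 < (d + 1) * ρ) h1
      (by norm_num : (0 : ℝ) < 2⁻¹) (by norm_num)
    refine (coins_spherePoint_le t n z hn2).trans ?_
    have hreal : (2⁻¹ : ℝ) ^ (freeCount t n * d) ≤ 2 ^ a * ((d + 1) ^ s * ρ ^ s) := by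
      have hN := (freeCount_bounds t ht0 ht1 n).1
      have hsq := mul_sqrt_le hκ (3 * d) n
      have hexp : -((freeCount t n * d : ℕ) : ℝ) ≤ a + -((n + 1 : ℕ) : ℝ) * s := by
        push_cast
        have hNd := mul_le_mul_of_nonneg_right hN (by positivity : (0 : ℝ) ≤ d)
        have : κ * n = d * (1 - t) * n - s * n := by rw [hκdef]; ring
        nlinarith
      calc (2⁻¹ : ℝ) ^ (freeCount t n * d) = 2 ^ (-((freeCount t n * d : ℕ) : ℝ)) :=
            inv_two_pow_eq_rpow _
        _ ≤ 2 ^ (a + -((n + 1 : ℕ) : ℝ) * s) := Real.rpow_le_rpow_of_exponent_le (by norm_num) hexp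
        _ = 2 ^ a * ((2⁻¹ : ℝ) ^ (n + 1)) ^ s := by
            rw [Real.rpow_add (by norm_num), Real.rpow_mul (by norm_num), inv_two_pow_eq_rpow]
        _ ≤ 2 ^ a * ((d + 1) * ρ) ^ s := by
            gcongr
        _ = _ := by rw [Real.mul_rpow hd.le hρ.le]
    calc (4 : ℝ≥0∞) ^ d * 2⁻¹ ^ (freeCount t n * d)
        = ENNReal.ofReal (4 ^ d * (2⁻¹ : ℝ) ^ (freeCount t n * d)) := by
          rw [ENNReal.ofReal_mul (by positivity), ENNReal.ofReal_pow (by norm_num),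
            ENNReal.ofReal_pow (by norm_num), ENNReal.ofReal_inv_of_pos (by norm_num)]
          simp
      _ ≤ _ := by
          refine ENNReal.ofReal_le_ofReal ?_
          calc 4 ^ d * (2⁻¹ : ℝ) ^ (freeCount t n * d)
              ≤ 4 ^ d * (2 ^ a * ((d + 1) ^ s * ρ ^ s)) := by gcongr
            _ = _ := by ring
  · refine prob_le_one.trans ?_
    rw [← ENNReal.ofReal_one]
    refine ENNReal.ofReal_le_ofReal ?_
    have e1 : (1 : ℝ) ≤ 4 ^ d := one_le_pow₀ (by norm_num)
    have e2 : (1 : ℝ) ≤ 2 ^ a := Real.one_le_rpow (by norm_num) ha0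
    have e3 : 1 ≤ ((d + 1) * ρ) ^ s := Real.one_le_rpow h1.le hs0
    rw [Real.mul_rpow hd.le hρ.le] at e3
    have e4 : (1 : ℝ) ≤ 4 ^ d * 2 ^ a := by nlinarith
    rw [mul_assoc]
    nlinarith

theorem measurableSet_spherePoint_near (t : ℝ) (z : Space d) (ρ : ℝ) :
    MeasurableSet {ω : ℕ × Fin d → Fin 2 | ‖(spherePoint t ω : Space d) - z‖ ≤ ρ} := by
  have h := measurable_subtype_coe.comp (measurable_spherePoint (d := d) t)
  exact measurableSet_le (h.sub_const z).norm measurable_const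

/-- A dyadic layer decomposition: for the least `k` with `D ≤ 2^k h` one has `2^k h ≤ 2 (h + D)`, so
that single term already dominates. -/
theorem ofReal_decayKernel_le_tsum (d : ℕ) {h D : ℝ} (hh : 0 < h) (hD : 0 ≤ D) :
    ENNReal.ofReal (decayKernel d h D) ≤
      ∑' k : ℕ, {k : ℕ | D ≤ 2 ^ k * h}.indicator
        (fun k => ENNReal.ofReal (2 ^ (d + 1) * (2⁻¹ ^ k) ^ (d + 1) / h ^ d)) k := by
  have hex : ∃ k : ℕ, D ≤ 2 ^ k * h := by
    obtain ⟨k, hk⟩ := pow_unbounded_of_one_lt (D / h) (by norm_num : (1 : ℝ) < 2)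
    exact ⟨k, ((div_lt_iff₀ hh).1 hk).le⟩
  classical
  set k := Nat.find hex with hk
  have hkD : D ≤ 2 ^ k * h := Nat.find_spec hex
  refine le_trans ?_ (ENNReal.le_tsum k)
  rw [indicator_of_mem (show k ∈ {k : ℕ | D ≤ 2 ^ k * h} from hkD)]
  refine ENNReal.ofReal_le_ofReal ?_
  have hlow : 2 ^ k * h ≤ 2 * (h + D) := by
    rcases Nat.eq_zero_or_pos k with h0 | h0
    · rw [h0]; linarith
    · have := Nat.find_min hex (show k - 1 < Nat.find hex by omega)
      rw [not_le] at this
      have e : (2 : ℝ) ^ k = 2 * 2 ^ (k - 1) := by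
        rw [← pow_succ']; congr 1; omega
      rw [e]; linarith
  rw [decayKernel, div_le_div_iff₀ (by positivity) (by positivity)]
  have h2 : (2 : ℝ) ^ k * 2⁻¹ ^ k = 1 := by rw [← mul_pow]; norm_num
  calc h * h ^ d = (2⁻¹ ^ k) ^ (d + 1) * (2 ^ k * h) ^ (d + 1) := by
        rw [← mul_pow, ← mul_assoc, mul_comm (2⁻¹ ^ k : ℝ), h2, one_mul, pow_succ]; ring
    _ ≤ (2⁻¹ ^ k) ^ (d + 1) * (2 * (h + D)) ^ (d + 1) := by gcongr
    _ = _ := by rw [mul_pow]; ring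

/-- The Poisson-type potential of a Frostman measure. -/
theorem exists_lintegral_decayKernel_le {t : ℝ} (ht0 : 0 ≤ t) (ht1 : t ≤ 1) {s : ℝ} (hs0 : 0 ≤ s)
    (hs : s = 0 ∨ s < d * (1 - t)) :
    ∃ C : ℝ, 0 < C ∧ ∀ (z : Space d) (h : ℝ), 0 < h →
      ∫⁻ ω, ENNReal.ofReal (decayKernel d h ‖(spherePoint t ω : Space d) - z‖) ∂(coins d) ≤
        ENNReal.ofReal (C * h ^ (s - d)) := by
  obtain ⟨C, hC, hF⟩ := exists_coins_spherePoint_le (d := d) ht0 ht1 hs0 hs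
  have hsd : s ≤ d := by
    rcases hs with rfl | hs
    · positivity
    · nlinarith [(by positivity : (0 : ℝ) ≤ d)]
  refine ⟨2 ^ (d + 1) * C * 2, by positivity, fun z h hh => ?_⟩
  let w : ℕ → ℝ := fun k => 2 ^ (d + 1) * (2⁻¹ ^ k) ^ (d + 1) / h ^ d
  let S : ℕ → Set (ℕ × Fin d → Fin 2) := fun k => {ω | ‖(spherePoint t ω : Space d) - z‖ ≤ 2 ^ k * h}
  have hterm : ∀ k, ENNReal.ofReal (w k) * coins d (S k) ≤
      ENNReal.ofReal (2 ^ (d + 1) * C * h ^ (s - d) * 2⁻¹ ^ k) := by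
    intro k
    refine (mul_le_mul_right (hF z (2 ^ k * h) (by positivity)) _).trans ?_
    rw [← ENNReal.ofReal_mul (by positivity)]
    refine ENNReal.ofReal_le_ofReal ?_
    -- As `s ≤ d`, the mass grows by at most `2^{kd}` against the kernel's `2^{-k(d+1)}`, leaving a
    -- geometric series.
    have h1 : ((2 : ℝ) ^ k * h) ^ s ≤ (2 ^ k) ^ d * h ^ s := by
      rw [Real.mul_rpow (by positivity) hh.le, ← Real.rpow_natCast _ d]
      gcongr
      exact one_le_pow₀ (by norm_num)
    have h2 : (2 : ℝ) ^ k * 2⁻¹ ^ k = 1 := by rw [← mul_pow]; norm_num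
    have h3 : ((2⁻¹ : ℝ) ^ k) ^ (d + 1) * (2 ^ k) ^ d = 2⁻¹ ^ k := by
      rw [pow_succ, mul_right_comm, ← mul_pow, mul_comm (2⁻¹ ^ k : ℝ), h2, one_pow, one_mul]
    calc w k * (C * (2 ^ k * h) ^ s) ≤ w k * (C * ((2 ^ k) ^ d * h ^ s)) := by gcongr
      _ = 2 ^ (d + 1) * C * (h ^ s / h ^ d) * ((2⁻¹ ^ k) ^ (d + 1) * (2 ^ k) ^ d) := by
          simp only [w]; ring
      _ = 2 ^ (d + 1) * C * h ^ (s - d) * 2⁻¹ ^ k := by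
          rw [h3, Real.rpow_sub hh, Real.rpow_natCast]
  calc ∫⁻ ω, ENNReal.ofReal (decayKernel d h ‖(spherePoint t ω : Space d) - z‖) ∂(coins d)
      ≤ ∫⁻ ω, ∑' k : ℕ, (S k).indicator (fun _ => ENNReal.ofReal (w k)) ω ∂(coins d) := by
        refine lintegral_mono fun ω => ?_
        refine (ofReal_decayKernel_le_tsum d hh (norm_nonneg _)).trans (le_of_eq ?_)
        refine tsum_congr fun k => ?_
        simp only [indicator, S, w, mem_ofPred_eq]
    _ = ∑' k, ENNReal.ofReal (w k) * coins d (S k) := by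
        rw [lintegral_tsum fun k => (measurable_const.indicator
          (measurableSet_spherePoint_near t z _)).aemeasurable]
        refine tsum_congr fun k => ?_
        rw [lintegral_indicator_const (measurableSet_spherePoint_near t z _)]
    _ ≤ ∑' k : ℕ, ENNReal.ofReal (2 ^ (d + 1) * C * h ^ (s - d) * 2⁻¹ ^ k) :=
        ENNReal.tsum_le_tsum hterm
    _ = ENNReal.ofReal (2 ^ (d + 1) * C * 2 * h ^ (s - d)) := by
        have hsum : Summable fun k : ℕ => (2⁻¹ : ℝ) ^ k :=
          summable_geometric_of_lt_one (by norm_num) (by norm_num)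
        rw [← ENNReal.ofReal_tsum_of_nonneg (fun k => by positivity) (hsum.mul_left _), tsum_mul_left,
          tsum_geometric_of_lt_one (by norm_num) (by norm_num)]
        congr 1
        norm_num
        ring

/-- A set that contains almost every `spherePoint` for the parameter `t` has Hausdorff dimension at
least `d (1 - t)`. -/
theorem le_dimH_of_ae_spherePoint {t : ℝ} (ht0 : 0 ≤ t) (ht1 : t ≤ 1) {E : Set (Space d)}
    (hE : ∀ᵐ ω ∂(coins d), (spherePoint t ω : Space d) ∈ E) :
    ENNReal.ofReal (d * (1 - t)) ≤ dimH E := by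
  refine ENNReal.le_of_forall_nnreal_lt fun s hs => ?_
  rcases eq_or_ne s 0 with rfl | hs0
  · simp
  have hs0' : (0 : ℝ) < s := by exact_mod_cast pos_iff_ne_zero.2 hs0
  have hs' : (s : ℝ) < d * (1 - t) := by
    rw [← ENNReal.ofReal_coe_nnreal] at hs
    exact (ENNReal.ofReal_lt_ofReal_iff_of_nonneg hs0'.le).1 hs
  obtain ⟨C, hC, hF⟩ := exists_coins_spherePoint_le (d := d) ht0 ht1 hs0'.le (Or.inr hs')
  have hmeas : Measurable fun ω : ℕ × Fin d → Fin 2 => (spherePoint t ω : Space d) :=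
    measurable_subtype_coe.comp (measurable_spherePoint t)
  set m : Measure (Space d) := (coins d).map fun ω => (spherePoint t ω : Space d) with hm
  -- Radius `0` is reached by a limit; it is needed for test sets of diameter `0`.
  have hball : ∀ (z : Space d) (ρ : ℝ), 0 ≤ ρ →
      m (Metric.closedBall z ρ) ≤ ENNReal.ofReal (C * ρ ^ (s : ℝ)) := by
    have hpos : ∀ (z : Space d) (ρ : ℝ), 0 < ρ →
        m (Metric.closedBall z ρ) ≤ ENNReal.ofReal (C * ρ ^ (s : ℝ)) := by
      intro z ρ hρ
      rw [hm, Measure.map_apply hmeas Metric.isClosed_closedBall.measurableSet]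
      refine le_trans (measure_mono fun ω hω => ?_) (hF z ρ hρ)
      exact mem_closedBall_iff_norm.1 hω
    intro z ρ hρ
    rcases hρ.eq_or_lt with rfl | hρ
    · have hlim : Tendsto (fun ρ : ℝ => ENNReal.ofReal (C * ρ ^ (s : ℝ))) (𝓝[>] 0)
          (𝓝 (ENNReal.ofReal (C * 0 ^ (s : ℝ)))) := by
        refine ENNReal.tendsto_ofReal (Tendsto.const_mul C ?_)
        exact ((Real.continuousAt_rpow_const 0 s (Or.inr hs0'.le)).tendsto).mono_left
          nhdsWithin_le_nhds
      refine ge_of_tendsto hlim ?_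
      filter_upwards [self_mem_nhdsWithin] with ρ (hρ : 0 < ρ)
      exact (measure_mono (Metric.closedBall_subset_closedBall hρ.le)).trans (hpos z ρ hρ)
    · exact hpos z ρ hρ
  have hmE : 1 ≤ m E := by
    refine le_trans ?_ (Measure.le_map_apply hmeas.aemeasurable E)
    have : (fun ω => (spherePoint t ω : Space d)) ⁻¹' E =ᵐ[coins d] univ := by
      filter_upwards [hE] with ω hω
      exact propext ⟨fun _ => trivial, fun _ => hω⟩
    rw [measure_congr this, measure_univ]
  -- Mass distribution principle.
  have hle : (ENNReal.ofReal C)⁻¹ • m ≤ μH[s] := by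
    refine Measure.le_hausdorffMeasure _ _ 1 one_pos fun A hA => ?_
    rcases A.eq_empty_or_nonempty with rfl | ⟨z, hz⟩
    · simp
    have hfin : Metric.ediam A ≠ ∞ := ne_top_of_le_ne_top ENNReal.one_ne_top hA
    have hsub : A ⊆ Metric.closedBall z (Metric.diam A) := fun y hy =>
      Metric.mem_closedBall.2 (Metric.dist_le_diam_of_mem' hfin hy hz)
    rw [Measure.smul_apply, smul_eq_mul]
    have h1 := (measure_mono hsub).trans (hball z _ Metric.diam_nonneg)
    rw [ENNReal.ofReal_mul hC.le, ← ENNReal.ofReal_rpow_of_nonneg Metric.diam_nonneg hs0'.le,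
      Metric.diam, ENNReal.ofReal_toReal hfin] at h1
    calc (ENNReal.ofReal C)⁻¹ * m A ≤ (ENNReal.ofReal C)⁻¹ *
          (ENNReal.ofReal C * Metric.ediam A ^ (s : ℝ)) := by gcongr
      _ = Metric.ediam A ^ (s : ℝ) := by
          rw [← mul_assoc, ENNReal.inv_mul_cancel (by simpa using hC) ENNReal.ofReal_ne_top, one_mul]
  refine le_dimH_of_hausdorffMeasure_ne_zero fun h0 => ?_
  have h1 := hle E
  rw [h0, Measure.smul_apply, smul_eq_mul, nonpos_iff_eq_zero, mul_eq_zero] at h1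
  rcases h1 with h1 | h1
  · exact ENNReal.ofReal_ne_top (ENNReal.inv_eq_zero.1 h1)
  · rw [h1] at hmE
    exact absurd hmE (by norm_num)

/-! ### The saturating density -/

/-- The density whose Poisson integral has all radial growth exponents. -/
noncomputable def saturatingDensity (d : ℕ) (ξ : Sph d) : ℝ≥0∞ :=
  ∑' n : ℕ, ∑ j ∈ Finset.range (n + 1), ENNReal.ofReal (2 ^ (n * d) / (n + 1) ^ 3) *
    coins d {ω | dist (spherePoint (j / n) ω) ξ ≤ (2 * d + 3) * (2⁻¹ : ℝ) ^ n}

theorem measurableSet_dist_spherePoint_le (t ρ : ℝ) :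
    MeasurableSet {p : Sph d × (ℕ × Fin d → Fin 2) | dist (spherePoint t p.2) p.1 ≤ ρ} :=
  measurableSet_le (((measurable_spherePoint t).comp measurable_snd).dist measurable_fst)
    measurable_const

theorem measurable_saturatingDensity (d : ℕ) : Measurable (saturatingDensity d) := by
  refine Measurable.tsum fun n => Finset.measurable_fun_sum _ fun j _ =>
    Measurable.const_mul ?_ _
  exact measurable_measure_prodMk_left (measurableSet_dist_spherePoint_le _ _)

theorem lintegral_coins_dist_le (t : ℝ) {ρ : ℝ} (hρ : 0 < ρ) :
    ∫⁻ ξ, coins d {ω | dist (spherePoint t ω) ξ ≤ ρ} ∂(sigma d) ≤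
      ENNReal.ofReal (2 ^ (d + 1) * ρ ^ d) := by
  have hS := measurableSet_dist_spherePoint_le (d := d) t ρ
  have h1 := Measure.prod_apply (μ := sigma d) (ν := coins d) hS
  rw [Measure.prod_apply_symm hS] at h1
  calc ∫⁻ ξ, coins d {ω | dist (spherePoint t ω) ξ ≤ ρ} ∂(sigma d)
      = ∫⁻ ω, sigma d (Metric.closedBall (spherePoint t ω) ρ) ∂(coins d) := by
        refine h1.symm.trans (lintegral_congr fun ω => ?_)
        congr 1
        ext ξ
        simp [dist_comm]
    _ ≤ ∫⁻ _ω, ENNReal.ofReal (2 ^ (d + 1) * ρ ^ d) ∂(coins d) :=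
        lintegral_mono fun ω => sigma_closedBall_le _ hρ
    _ = _ := by simp

/-- By Fubini each ball term has integral of order `2^{-nd}`, cancelling `2^{nd}`; the `n + 1`
values of `j` and the weight `(n + 1)^{-3}` leave `∑ (n + 1)^{-2}`. -/
theorem lintegral_saturatingDensity_lt_top (d : ℕ) :
    ∫⁻ ξ, saturatingDensity d ξ ∂(sigma d) < ∞ := by
  have hmeas : ∀ n j : ℕ, Measurable fun ξ : Sph d =>
      ENNReal.ofReal (2 ^ (n * d) / (n + 1) ^ 3) *
        coins d {ω | dist (spherePoint (j / n) ω) ξ ≤ (2 * d + 3) * (2⁻¹ : ℝ) ^ n} := fun n j =>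
    Measurable.const_mul (measurable_measure_prodMk_left (measurableSet_dist_spherePoint_le _ _)) _
  have hterm : ∀ n : ℕ, ∫⁻ ξ, ∑ j ∈ Finset.range (n + 1), ENNReal.ofReal (2 ^ (n * d) / (n + 1) ^ 3) *
      coins d {ω | dist (spherePoint (j / n) ω) ξ ≤ (2 * d + 3) * (2⁻¹ : ℝ) ^ n} ∂(sigma d) ≤
      ENNReal.ofReal (2 ^ (d + 1) * (2 * d + 3) ^ d * (1 / ((n + 1 : ℕ) : ℝ) ^ 2)) := by
    intro n
    rw [lintegral_finsetSum _ fun j _ => hmeas n j]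
    calc ∑ j ∈ Finset.range (n + 1), ∫⁻ ξ, ENNReal.ofReal (2 ^ (n * d) / (n + 1) ^ 3) *
          coins d {ω | dist (spherePoint (j / n) ω) ξ ≤ (2 * d + 3) * (2⁻¹ : ℝ) ^ n} ∂(sigma d)
        ≤ ∑ _j ∈ Finset.range (n + 1), ENNReal.ofReal (2 ^ (n * d) / (n + 1) ^ 3) *
          ENNReal.ofReal (2 ^ (d + 1) * ((2 * d + 3) * (2⁻¹ : ℝ) ^ n) ^ d) := by
          refine Finset.sum_le_sum fun j _ => ?_
          rw [lintegral_const_mul' _ _ ENNReal.ofReal_ne_top]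
          gcongr
          exact lintegral_coins_dist_le _ (by positivity)
      _ = _ := by
          rw [Finset.sum_const, Finset.card_range, nsmul_eq_mul, ← ENNReal.ofReal_mul (by positivity),
            ← ENNReal.ofReal_natCast, ← ENNReal.ofReal_mul (by positivity)]
          congr 1
          have h2 : (2 : ℝ) ^ (n * d) * ((2⁻¹ : ℝ) ^ n) ^ d = 1 := by
            rw [← pow_mul, ← mul_pow]; norm_num
          rw [mul_pow]
          push_cast
          calc ((n : ℝ) + 1) * (2 ^ (n * d) / ((n : ℝ) + 1) ^ 3 *
                (2 ^ (d + 1) * ((2 * (d : ℝ) + 3) ^ d * ((2⁻¹ : ℝ) ^ n) ^ d)))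
              = 2 ^ (d + 1) * (2 * (d : ℝ) + 3) ^ d * (2 ^ (n * d) * ((2⁻¹ : ℝ) ^ n) ^ d) *
                (((n : ℝ) + 1) / ((n : ℝ) + 1) ^ 3) := by ring
            _ = _ := by
                rw [h2, mul_one]
                congr 1
                field_simp
  unfold saturatingDensity
  rw [lintegral_tsum fun n => (Finset.measurable_fun_sum _ fun j _ => hmeas n j).aemeasurable]
  refine (ENNReal.tsum_le_tsum hterm).trans_lt ?_
  have hsum : Summable fun n : ℕ =>
      2 ^ (d + 1) * (2 * (d : ℝ) + 3) ^ d * (1 / ((n + 1 : ℕ) : ℝ) ^ 2) :=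
    ((summable_nat_add_iff 1 (f := fun n : ℕ => 1 / (n : ℝ) ^ 2)).2
      (Real.summable_one_div_nat_pow.2 one_lt_two)).mul_left _
  rw [← ENNReal.ofReal_tsum_of_nonneg (fun n => by positivity) hsum]
  exact ENNReal.ofReal_lt_top

/-- Rounding `t` down to `t'` only frees more digits, so the `t'`-free digits can copy the first `n`
masked digits of `ω`. The resulting cylinder lands within `2 (d + 1) 2^{-n}` of the point, and `ξ`
adds one more `2^{-n}`: this is the radius `(2d + 3) 2^{-n}` of the density. -/
theorem le_saturatingDensity {t : ℝ} (ht0 : 0 ≤ t) (ht1 : t ≤ 1) (n : ℕ)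
    (ω : ℕ × Fin d → Fin 2) {ξ : Sph d} (hξ : dist (spherePoint t ω) ξ ≤ (2⁻¹ : ℝ) ^ n) :
    ENNReal.ofReal (2 ^ (n * d) / (n + 1) ^ 3 *
      (2⁻¹ : ℝ) ^ (freeCount ((⌊t * n⌋₊ : ℝ) / n) n * d)) ≤ saturatingDensity d ξ := by
  set t' : ℝ := (⌊t * n⌋₊ : ℝ) / n with ht'
  have hfloor : (⌊t * n⌋₊ : ℝ) ≤ t * n := Nat.floor_le (by positivity)
  have htt : t' ≤ t := by
    -- For `n = 0` the quotient is `0` by convention.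
    rcases Nat.eq_zero_or_pos n with rfl | hn
    · simpa [ht'] using ht0
    · rw [ht', div_le_iff₀ (by exact_mod_cast hn)]
      exact hfloor
  have hmem : ⌊t * n⌋₊ ∈ Finset.range (n + 1) := by
    rw [Finset.mem_range, Nat.lt_succ_iff]
    refine Nat.floor_le_of_le ?_
    have : (0 : ℝ) ≤ n := by positivity
    nlinarith
  have hcyl : (2⁻¹ : ℝ≥0∞) ^ (freeCount t' n * d) ≤
      coins d {ω' | dist (spherePoint t' ω') ξ ≤ (2 * d + 3) * (2⁻¹ : ℝ) ^ n} := by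
    rw [← card_freePositions, ← coins_cylinder _ fun p => coordDigits t ω p.2 p.1]
    refine measure_mono fun ω' hω' => ?_
    have h1 := dist_spherePoint_le htt hω'
    have h2 := dist_triangle (spherePoint t' ω') (spherePoint t ω) ξ
    rw [mem_ofPred_eq]
    linarith
  refine le_trans ?_ (ENNReal.le_tsum n)
  refine le_trans ?_ (Finset.single_le_sum (fun _ _ => zero_le) hmem)
  rw [ENNReal.ofReal_mul (by positivity), ENNReal.ofReal_pow (by norm_num),
    ENNReal.ofReal_inv_of_pos (by norm_num), ENNReal.ofReal_ofNat]
  gcongr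

/-! ### Growth of the potential from below and from above -/

/-- The weighted potential of the density at height `h`. -/
noncomputable def saturatingPotential (d : ℕ) (h : ℝ) (x : Space d) : ℝ≥0∞ :=
  ∫⁻ ξ, ENNReal.ofReal (decayKernel d h ‖x - ξ‖) * saturatingDensity d ξ ∂(sigma d)

/-- On the cap of radius `2^{-n}` the kernel is at least of order `2^{nd}` and the cap has measure
at least of order `2^{-nd}`; the two cancel and the bound for the density survives. -/
theorem le_saturatingPotential {t : ℝ} (ht0 : 0 ≤ t) (ht1 : t ≤ 1) (n : ℕ)
    (ω : ℕ × Fin d → Fin 2) {h : ℝ} (h1 : (2⁻¹ : ℝ) ^ (n + 1) < h) (h2 : h ≤ (2⁻¹ : ℝ) ^ n) :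
    ENNReal.ofReal (1 / (2 ^ (d + 2) * ((d + 1) * 4 ^ (d + 1))) * (2 ^ (n * d) / (n + 1) ^ 3) *
      (2⁻¹ : ℝ) ^ (freeCount ((⌊t * n⌋₊ : ℝ) / n) n * d)) ≤
      saturatingPotential d h (spherePoint t ω) := by
  set ρ : ℝ := (2⁻¹ : ℝ) ^ n with hρdef
  have hρ : 0 < ρ := by positivity
  have hρ1 : ρ ≤ 1 := pow_le_one₀ (by norm_num) (by norm_num)
  have hh : 0 < h := lt_trans (by positivity) h1
  set A : ℝ := 2 ^ (n * d) / (n + 1) ^ 3 * (2⁻¹ : ℝ) ^ (freeCount ((⌊t * n⌋₊ : ℝ) / n) n * d) with hA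
  have hA0 : 0 ≤ A := by positivity
  have hker : ∀ D : ℝ, 0 ≤ D → D ≤ ρ → 1 / (2 ^ (d + 2) * ρ ^ d) ≤ decayKernel d h D := by
    intro D hD0 hD
    rw [decayKernel, div_le_div_iff₀ (by positivity) (by positivity), one_mul]
    have h3 : ρ ≤ 2 * h := by
      have : (2⁻¹ : ℝ) ^ (n + 1) = ρ / 2 := by rw [pow_succ]; ring
      linarith
    calc (h + D) ^ (d + 1) ≤ (2 * ρ) ^ (d + 1) := by gcongr; linarith
      _ = 2 ^ (d + 1) * ρ ^ d * ρ := by rw [mul_pow, pow_succ ρ]; ring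
      _ ≤ 2 ^ (d + 1) * ρ ^ d * (2 * h) := by gcongr
      _ = _ := by ring
  calc ENNReal.ofReal (1 / (2 ^ (d + 2) * ((d + 1) * 4 ^ (d + 1))) * (2 ^ (n * d) / (n + 1) ^ 3) *
        (2⁻¹ : ℝ) ^ (freeCount ((⌊t * n⌋₊ : ℝ) / n) n * d))
      = ENNReal.ofReal (1 / (2 ^ (d + 2) * ρ ^ d)) * ENNReal.ofReal A *
        ENNReal.ofReal (ρ ^ d / ((d + 1) * 4 ^ (d + 1))) := by
        rw [← ENNReal.ofReal_mul (by positivity), ← ENNReal.ofReal_mul (by positivity)]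
        congr 1
        rw [hA]
        field_simp
    _ ≤ ENNReal.ofReal (1 / (2 ^ (d + 2) * ρ ^ d)) * ENNReal.ofReal A *
        sigma d (Metric.closedBall (spherePoint t ω) ρ) := by
        gcongr
        exact le_sigma_closedBall _ hρ hρ1
    _ = ∫⁻ _ξ in Metric.closedBall (spherePoint t ω) ρ,
          ENNReal.ofReal (1 / (2 ^ (d + 2) * ρ ^ d)) * ENNReal.ofReal A ∂(sigma d) := by
        rw [setLIntegral_const]
    _ ≤ ∫⁻ ξ in Metric.closedBall (spherePoint t ω) ρ,
          ENNReal.ofReal (decayKernel d h ‖(spherePoint t ω : Space d) - ξ‖) *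
            saturatingDensity d ξ ∂(sigma d) := by
        refine setLIntegral_mono' Metric.isClosed_closedBall.measurableSet fun ξ hξ => ?_
        have hdist : dist (spherePoint t ω) ξ ≤ ρ := by rwa [dist_comm]
        have hnorm : ‖(spherePoint t ω : Space d) - ξ‖ ≤ ρ := by
          rwa [← dist_eq_norm, ← Subtype.dist_eq]
        gcongr
        · exact hker _ (norm_nonneg _) hnorm
        · exact le_saturatingDensity ht0 ht1 n ω hdist
    _ ≤ _ := setLIntegral_le_lintegral _ _

theorem rpow_neg_le_two_rpow {n : ℕ} {h : ℝ} (h1 : (2⁻¹ : ℝ) ^ (n + 1) < h)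
    (h2 : h ≤ (2⁻¹ : ℝ) ^ n) (γ : ℝ) : h ^ (-γ) ≤ 2 ^ (γ * n + |γ|) := by
  have hh : 0 < h := lt_trans (by positivity) h1
  rcases le_total 0 γ with hγ | hγ
  · refine (Real.rpow_le_rpow_of_nonpos (by positivity) h1.le (by linarith)).trans ?_
    rw [inv_two_pow_eq_rpow, ← Real.rpow_mul (by norm_num), abs_of_nonneg hγ]
    refine Real.rpow_le_rpow_of_exponent_le (by norm_num) (le_of_eq ?_)
    push_cast; ring
  · refine (Real.rpow_le_rpow hh.le h2 (by linarith)).trans ?_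
    rw [inv_two_pow_eq_rpow, ← Real.rpow_mul (by norm_num)]
    refine Real.rpow_le_rpow_of_exponent_le (by norm_num) ?_
    have := abs_nonneg γ
    linarith

/-- Puts the polynomial weight of the density on the same `√n` scale as the counting errors. -/
theorem succ_pow_three_le (n : ℕ) : ((n : ℝ) + 1) ^ 3 ≤ 2 ^ (12 * √(n : ℝ)) := by
  have h0 := Real.sqrt_nonneg (n : ℝ)
  have h1 : √(n : ℝ) ^ 2 = n := Real.sq_sqrt (by positivity)
  have h2 : √(n : ℝ) + 1 ≤ 2 ^ (2 * √(n : ℝ)) := by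
    rcases Nat.eq_zero_or_pos n with rfl | hn
    · simp
    · have h3 : (1 : ℝ) ≤ √(n : ℝ) := by
        rw [Real.one_le_sqrt]; exact_mod_cast hn
      have h4 := one_add_mul_self_le_rpow_one_add (s := 3) (by norm_num) h3
      rw [Real.rpow_mul (by norm_num)]
      norm_num at h4 ⊢
      linarith
  calc ((n : ℝ) + 1) ^ 3 ≤ ((√(n : ℝ) + 1) ^ 2) ^ 3 := by
        gcongr; nlinarith
    _ = (√(n : ℝ) + 1) ^ 6 := by ring
    _ ≤ (2 ^ (2 * √(n : ℝ))) ^ 6 := by gcongr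
    _ = _ := by
        rw [← Real.rpow_natCast, ← Real.rpow_mul (by norm_num)]
        congr 1; push_cast; ring

/-- Lower bound for the growth of the potential, at every point with masked digits. -/
theorem exists_rpow_le_saturatingPotential {t : ℝ} (ht0 : 0 ≤ t) (ht1 : t ≤ 1) {γ : ℝ}
    (hγ : γ < d * t) :
    ∃ n₀ : ℕ, ∀ n ≥ n₀, ∀ (ω : ℕ × Fin d → Fin 2) (h : ℝ), (2⁻¹ : ℝ) ^ (n + 1) < h →
      h ≤ (2⁻¹ : ℝ) ^ n →
      ENNReal.ofReal (h ^ (-γ)) ≤ saturatingPotential d h (spherePoint t ω) := by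
  -- Half of the linear gap absorbs the `√n` terms; the other half absorbs the constants once `n ≥
  -- n₀`.
  set κ : ℝ := (d * t - γ) / 2 with hκdef
  have hκ : 0 < κ := by rw [hκdef]; linarith
  set c : ℝ := 1 / (2 ^ (d + 2) * ((d + 1) * 4 ^ (d + 1))) with hc
  have hc0 : 0 < c := by positivity
  set a : ℝ := Real.logb 2 c with ha
  have hca : c = 2 ^ a := (Real.rpow_logb (by norm_num) (by norm_num) hc0).symm
  obtain ⟨n₀, hn₀⟩ := exists_nat_ge
    (((12 + 3 * d) ^ 2 / (4 * κ) + |γ| + 2 * d - a) / κ)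
  refine ⟨n₀ + 1, fun n hn ω h h1 h2 => ?_⟩
  refine le_trans (ENNReal.ofReal_le_ofReal ?_) (le_saturatingPotential ht0 ht1 n ω h1 h2)
  refine (rpow_neg_le_two_rpow h1 h2 γ).trans ?_
  have hnpos : (0 : ℝ) < n := by exact_mod_cast (by omega : 0 < n)
  set t' : ℝ := (⌊t * n⌋₊ : ℝ) / n with ht'
  have ht'n : t' * n = ⌊t * n⌋₊ := by rw [ht', div_mul_cancel₀ _ hnpos.ne']
  have hfl : t * n - 1 < ⌊t * n⌋₊ := Nat.sub_one_lt_floor _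
  have hfl' : (⌊t * n⌋₊ : ℝ) ≤ t * n := Nat.floor_le (by positivity)
  have ht'0 : 0 ≤ t' := by positivity
  have ht'1 : t' ≤ 1 := by
    rw [ht', div_le_one hnpos]; nlinarith
  have hN := (freeCount_bounds t' ht'0 ht'1 n).2
  have hN' : (freeCount t' n : ℝ) ≤ (1 - t) * n + 3 * √n + 2 := by nlinarith
  have hNd := mul_le_mul_of_nonneg_right hN' (by positivity : (0 : ℝ) ≤ d)
  have hsq := mul_sqrt_le hκ (12 + 3 * d) n
  have hn' : ((12 + 3 * d) ^ 2 / (4 * κ) + |γ| + 2 * d - a) ≤ κ * n := by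
    rw [div_le_iff₀ hκ] at hn₀
    have : (n₀ : ℝ) ≤ n := by exact_mod_cast (by omega : n₀ ≤ n)
    nlinarith
  have hexp : γ * n + |γ| ≤ a + ((n * d : ℕ) : ℝ) - 12 * √(n : ℝ) +
      -((freeCount t' n * d : ℕ) : ℝ) := by
    push_cast
    have : 2 * (κ * n) = d * t * n - γ * n := by rw [hκdef]; ring
    nlinarith
  calc (2 : ℝ) ^ (γ * n + |γ|)
      ≤ 2 ^ (a + ((n * d : ℕ) : ℝ) - 12 * √(n : ℝ) + -((freeCount t' n * d : ℕ) : ℝ)) :=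
        Real.rpow_le_rpow_of_exponent_le (by norm_num) hexp
    _ = c * (2 ^ (n * d) / 2 ^ (12 * √(n : ℝ))) * (2⁻¹ : ℝ) ^ (freeCount t' n * d) := by
        rw [Real.rpow_add (by norm_num), Real.rpow_sub (by norm_num), Real.rpow_add (by norm_num),
          ← hca, Real.rpow_natCast, inv_two_pow_eq_rpow, mul_div_assoc]
    _ ≤ c * (2 ^ (n * d) / (n + 1) ^ 3) * (2⁻¹ : ℝ) ^ (freeCount t' n * d) := by
        gcongr
        exact succ_pow_three_le n

theorem decayKernel_le_of_dyadic {n : ℕ} {h D : ℝ} (hD : 0 ≤ D) (h1 : (2⁻¹ : ℝ) ^ (n + 1) < h)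
    (h2 : h ≤ (2⁻¹ : ℝ) ^ n) :
    decayKernel d h D ≤ 2 ^ (d + 1) * decayKernel d ((2⁻¹ : ℝ) ^ n) D := by
  have hh : 0 < h := lt_trans (by positivity) h1
  rw [decayKernel, decayKernel, ← mul_div_assoc, div_le_div_iff₀ (by positivity) (by positivity)]
  have h3 : (2⁻¹ : ℝ) ^ n ≤ 2 * h := by
    have : (2⁻¹ : ℝ) ^ (n + 1) = (2⁻¹ : ℝ) ^ n / 2 := by rw [pow_succ]; ring
    linarith
  calc h * ((2⁻¹ : ℝ) ^ n + D) ^ (d + 1) ≤ (2⁻¹ : ℝ) ^ n * (2 * (h + D)) ^ (d + 1) := by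
        gcongr; linarith
    _ = _ := by rw [mul_pow]; ring

/-- Upper bound for the growth of the potential, at almost every point with masked digits. -/
theorem ae_exists_saturatingPotential_le {t : ℝ} (ht0 : 0 ≤ t) (ht1 : t ≤ 1) {γ : ℝ}
    (hγ : d * t < γ) :
    ∀ᵐ ω ∂(coins d), ∃ M : ℝ≥0∞, M ≠ ∞ ∧ ∀ h : ℝ, 0 < h → h ≤ 1 →
      saturatingPotential d h (spherePoint t ω) ≤ M * ENNReal.ofReal (h ^ (-γ)) := by
  set η : ℝ := (γ - d * t) / 2 with hηdef
  have hη : 0 < η := by rw [hηdef]; linarith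
  -- When no positive exponent is available, as at `t = 1`, the trivial Frostman estimate `s = 0`
  -- suffices. In both cases `γ + s - d ≥ η`, so the weighted dyadic terms decay geometrically.
  set s : ℝ := max (d * (1 - t) - η) 0 with hs
  have hs0 : 0 ≤ s := le_max_right _ _
  have hs1 : s = 0 ∨ s < d * (1 - t) := by
    rcases le_total (d * (1 - t) - η) 0 with h | h
    · left; rw [hs, max_eq_right h]
    · right; rw [hs, max_eq_left h]; linarith
  have hs2 : d - s ≤ γ - η := by
    have := le_max_left (d * (1 - t) - η) 0
    rw [← hs] at this
    have e : (d : ℝ) * (1 - t) = d - d * t := by ring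
    rw [e] at this
    have : γ = d * t + 2 * η := by rw [hηdef]; ring
    linarith
  have hγ0 : 0 ≤ γ := le_trans (by positivity) hγ.le
  obtain ⟨C, hC, hpot⟩ := exists_lintegral_decayKernel_le (d := d) ht0 ht1 hs0 hs1
  set H : ℕ → ℝ := fun n => (2⁻¹ : ℝ) ^ n with hH
  have hHpos : ∀ n, 0 < H n := fun n => by positivity
  have hHle : ∀ n, H n ≤ 1 := fun n => pow_le_one₀ (by norm_num) (by norm_num)
  have hmeasK : ∀ n, Measurable fun p : (ℕ × Fin d → Fin 2) × Sph d =>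
      ENNReal.ofReal (decayKernel d (H n) ‖(spherePoint t p.1 : Space d) - p.2‖) *
        saturatingDensity d p.2 := by
    intro n
    refine Measurable.mul ?_ ((measurable_saturatingDensity d).comp measurable_snd)
    refine ENNReal.measurable_ofReal.comp ((measurable_decayKernel d _).comp ?_)
    exact ((measurable_subtype_coe.comp ((measurable_spherePoint t).comp measurable_fst)).sub
      (measurable_subtype_coe.comp measurable_snd)).norm
  have hmeasP : ∀ n, Measurable fun ω : ℕ × Fin d → Fin 2 =>
      saturatingPotential d (H n) (spherePoint t ω) := fun n => (hmeasK n).lintegral_prod_right'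
  set I : ℝ≥0∞ := ∫⁻ ξ, saturatingDensity d ξ ∂(sigma d) with hI
  have hIfin : I < ∞ := lintegral_saturatingDensity_lt_top d
  have hint : ∀ n, ∫⁻ ω, saturatingPotential d (H n) (spherePoint t ω) ∂(coins d) ≤
      ENNReal.ofReal (C * H n ^ (s - d)) * I := by
    intro n
    unfold saturatingPotential
    rw [lintegral_lintegral_swap (hmeasK n).aemeasurable, hI,
      ← lintegral_const_mul' _ _ ENNReal.ofReal_ne_top]
    refine lintegral_mono fun ξ => ?_
    rw [lintegral_mul_const]
    · gcongr
      exact hpot ξ (H n) (hHpos n)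
    · refine ENNReal.measurable_ofReal.comp ((measurable_decayKernel d _).comp ?_)
      exact ((measurable_subtype_coe.comp (measurable_spherePoint t)).sub_const _).norm
  -- The series over all dyadic heights has finite mean, so it is finite almost surely, and its sum
  -- bounds every term at once.
  have htot : ∫⁻ ω, ∑' n, ENNReal.ofReal (H n ^ γ) *
      saturatingPotential d (H n) (spherePoint t ω) ∂(coins d) ≠ ∞ := by
    rw [lintegral_tsum fun n => ((hmeasP n).const_mul _).aemeasurable]
    have hterm : ∀ n, ∫⁻ ω, ENNReal.ofReal (H n ^ γ) *
        saturatingPotential d (H n) (spherePoint t ω) ∂(coins d) ≤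
        ENNReal.ofReal (C * ((2⁻¹ : ℝ) ^ η) ^ n) * I := by
      intro n
      rw [lintegral_const_mul _ (hmeasP n)]
      refine (mul_le_mul_right (hint n) _).trans ?_
      rw [← mul_assoc, ← ENNReal.ofReal_mul (by have := hHpos n; positivity)]
      refine mul_le_mul' (ENNReal.ofReal_le_ofReal ?_) le_rfl
      have e : H n ^ γ * H n ^ (s - d) ≤ H n ^ η := by
        rw [← Real.rpow_add (hHpos n)]
        exact Real.rpow_le_rpow_of_exponent_ge (hHpos n) (hHle n) (by linarith)
      have e2 : H n ^ η = ((2⁻¹ : ℝ) ^ η) ^ n := by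
        simp only [hH]
        rw [← Real.rpow_natCast, ← Real.rpow_natCast, ← Real.rpow_mul (by norm_num),
          ← Real.rpow_mul (by norm_num), mul_comm]
      rw [← e2]
      calc H n ^ γ * (C * H n ^ (s - d)) = C * (H n ^ γ * H n ^ (s - d)) := by ring
        _ ≤ _ := by gcongr
    refine ne_top_of_le_ne_top ?_ (ENNReal.tsum_le_tsum hterm)
    rw [ENNReal.tsum_mul_right]
    refine ENNReal.mul_ne_top ?_ hIfin.ne
    have hsum : Summable fun n : ℕ => C * ((2⁻¹ : ℝ) ^ η) ^ n :=
      (summable_geometric_of_lt_one (by positivity)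
        (Real.rpow_lt_one (by norm_num) (by norm_num) hη)).mul_left C
    rw [← ENNReal.ofReal_tsum_of_nonneg (fun n => by positivity) hsum]
    exact ENNReal.ofReal_ne_top
  filter_upwards [ae_lt_top (Measurable.tsum fun n => (hmeasP n).const_mul _) htot]
    with ω hω
  refine ⟨2 ^ (d + 1) * ∑' n, ENNReal.ofReal (H n ^ γ) *
      saturatingPotential d (H n) (spherePoint t ω), ENNReal.mul_ne_top (by finiteness) hω.ne,
    fun h hh hh1 => ?_⟩
  obtain ⟨n, hn1, hn2⟩ := exists_nat_pow_near_of_lt_one hh hh1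
    (by norm_num : (0 : ℝ) < 2⁻¹) (by norm_num)
  have hstep : saturatingPotential d h (spherePoint t ω) ≤
      2 ^ (d + 1) * saturatingPotential d (H n) (spherePoint t ω) := by
    unfold saturatingPotential
    rw [← lintegral_const_mul' _ _ (by finiteness)]
    refine lintegral_mono fun ξ => ?_
    rw [← mul_assoc]
    gcongr
    refine (ENNReal.ofReal_le_ofReal (decayKernel_le_of_dyadic (norm_nonneg _) hn1 hn2)).trans
      (le_of_eq ?_)
    rw [ENNReal.ofReal_mul (by positivity), ENNReal.ofReal_pow (by norm_num), ENNReal.ofReal_ofNat]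
  refine hstep.trans ?_
  rw [mul_assoc]
  gcongr
  have hone : ENNReal.ofReal (H n ^ γ) * ENNReal.ofReal (H n ^ (-γ)) = 1 := by
    rw [← ENNReal.ofReal_mul (by positivity), ← Real.rpow_add (hHpos n), add_neg_cancel,
      Real.rpow_zero, ENNReal.ofReal_one]
  calc saturatingPotential d (H n) (spherePoint t ω)
      = ENNReal.ofReal (H n ^ γ) * saturatingPotential d (H n) (spherePoint t ω) *
        ENNReal.ofReal (H n ^ (-γ)) := by
        rw [mul_right_comm, hone, one_mul]
    _ ≤ (∑' n, ENNReal.ofReal (H n ^ γ) * saturatingPotential d (H n) (spherePoint t ω)) *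
        ENNReal.ofReal (h ^ (-γ)) := by
        gcongr ?_ * ?_
        · exact ENNReal.le_tsum (f := fun n => ENNReal.ofReal (H n ^ γ) *
            saturatingPotential d (H n) (spherePoint t ω)) n
        · exact ENNReal.ofReal_le_ofReal
            (Real.rpow_le_rpow_of_nonpos hh hn2 (by linarith))

/-! ### Radial exponents of the saturating function -/

/-- The saturating function with values in `ℝ`. -/
noncomputable def saturatingFunction (d : ℕ) (ξ : Sph d) : ℝ := (saturatingDensity d ξ).toReal

theorem integrable_saturatingFunction (d : ℕ) : Integrable (saturatingFunction d) (sigma d) :=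
  integrable_toReal_of_lintegral_ne_top (measurable_saturatingDensity d).aemeasurable
    (lintegral_saturatingDensity_lt_top d).ne

theorem saturatingFunction_nonneg (ξ : Sph d) : 0 ≤ saturatingFunction d ξ := ENNReal.toReal_nonneg

theorem enorm_poissonIntegral_le_saturatingPotential {x : Space d} (hx : ‖x‖ = 1) {r : ℝ}
    (hr0 : 0 < r) (hr : r < 1) :
    ‖poissonIntegral (saturatingFunction d) (r • x)‖ₑ ≤
      2 * 3 ^ (d + 1) * saturatingPotential d (1 - r) x := by
  refine (enorm_poissonIntegral_le hx hr0 hr).trans ?_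
  unfold saturatingPotential
  gcongr with ξ
  rw [Real.enorm_of_nonneg (saturatingFunction_nonneg ξ)]
  exact ENNReal.ofReal_toReal_le

/-- Integrability has to be checked first, since otherwise the Bochner integral would be `0` by
convention; it holds because the kernel is bounded at fixed `r < 1`. Passing to `toReal` loses
nothing almost everywhere, the density being almost everywhere finite. -/
theorem saturatingPotential_le_enorm_poissonIntegral {x : Space d} (hx : ‖x‖ = 1) {r : ℝ}
    (hr0 : 0 < r) (hr : r < 1) :
    saturatingPotential d (1 - r) x ≤ ‖poissonIntegral (saturatingFunction d) (r • x)‖ₑ := by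
  have hrx : ‖r • x‖ ≤ 1 := by
    rw [norm_smul, hx, mul_one, Real.norm_of_nonneg hr0.le]; exact hr.le
  have hmeas : Measurable fun ξ : Sph d => poissonKernel d (r • x) ξ := by
    unfold poissonKernel; fun_prop
  have hnonneg : ∀ ξ, 0 ≤ poissonKernel d (r • x) ξ * saturatingFunction d ξ := fun ξ =>
    mul_nonneg (poissonKernel_nonneg hrx ξ) (saturatingFunction_nonneg ξ)
  have hbdd : ∀ ξ : Sph d, ‖poissonKernel d (r • x) ξ‖ ≤
      2 * 3 ^ (d + 1) * ((1 - r) / (1 - r) ^ (d + 1)) := by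
    intro ξ
    rw [Real.norm_of_nonneg (poissonKernel_nonneg hrx ξ)]
    refine (poissonKernel_le hx hr0 hr ξ).trans ?_
    have h1 : 0 < 1 - r := by linarith
    unfold decayKernel
    gcongr
    exact le_add_of_nonneg_right (norm_nonneg _)
  have hint : Integrable (fun ξ => poissonKernel d (r • x) ξ * saturatingFunction d ξ) (sigma d) :=
    (integrable_saturatingFunction d).bdd_mul hmeas.aestronglyMeasurable (Eventually.of_forall hbdd)
  have hval : ‖poissonIntegral (saturatingFunction d) (r • x)‖ₑ =
      ∫⁻ ξ, ENNReal.ofReal (poissonKernel d (r • x) ξ * saturatingFunction d ξ) ∂(sigma d) := by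
    rw [← ofReal_integral_eq_lintegral_ofReal hint (Eventually.of_forall hnonneg),
      ← Real.enorm_of_nonneg (integral_nonneg hnonneg)]
    rfl
  rw [hval]
  refine lintegral_mono_ae ?_
  filter_upwards [ae_lt_top (measurable_saturatingDensity d)
    (lintegral_saturatingDensity_lt_top d).ne] with ξ hξ
  rw [ENNReal.ofReal_mul (poissonKernel_nonneg hrx ξ), saturatingFunction,
    ENNReal.ofReal_toReal hξ.ne]
  gcongr
  exact decayKernel_le_poissonKernel hx hr0 hr ξ

theorem norm_spherePoint (t : ℝ) (ω : ℕ × Fin d → Fin 2) : ‖(spherePoint t ω : Space d)‖ = 1 := by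
  simp

theorem eventually_le_radialExponent_spherePoint {t : ℝ} (ht0 : 0 ≤ t) (ht1 : t ≤ 1) {γ : ℝ}
    (hγ : γ < d * t) (ω : ℕ × Fin d → Fin 2) :
    ∀ᶠ r in 𝓝[<] (1 : ℝ),
      (γ : EReal) ≤ radialExponent (saturatingFunction d) (spherePoint t ω) r := by
  obtain ⟨n₀, hn₀⟩ := exists_rpow_le_saturatingPotential ht0 ht1 hγ
  have hpos : (1 : ℝ) - (2⁻¹ : ℝ) ^ n₀ < 1 := by
    have : (0 : ℝ) < (2⁻¹ : ℝ) ^ n₀ := by positivity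
    linarith
  filter_upwards [eventually_Ioo_nhdsLT_one, Ioo_mem_nhdsLT hpos] with r hr hr'
  rw [le_radialExponent_iff γ hr.1 hr.2]
  obtain ⟨n, hn1, hn2⟩ := exists_nat_pow_near_of_lt_one (sub_pos.2 hr.2)
    (by linarith [hr.1] : 1 - r ≤ 1) (by norm_num : (0 : ℝ) < 2⁻¹) (by norm_num)
  have hn : n₀ ≤ n := by
    have h1 : (2⁻¹ : ℝ) ^ (n + 1) < (2⁻¹ : ℝ) ^ n₀ := by linarith [hr'.1]
    have := (pow_lt_pow_iff_right_of_lt_one₀ (by norm_num) (by norm_num)).1 h1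
    omega
  exact (hn₀ n hn ω (1 - r) hn1 hn2).trans
    (saturatingPotential_le_enorm_poissonIntegral (norm_spherePoint t ω) hr.1 hr.2)

theorem ae_eventually_radialExponent_spherePoint_le {t : ℝ} (ht0 : 0 ≤ t) (ht1 : t ≤ 1) {γ : ℝ}
    (hγ : d * t < γ) :
    ∀ᵐ ω ∂(coins d), ∀ᶠ r in 𝓝[<] (1 : ℝ),
      radialExponent (saturatingFunction d) (spherePoint t ω) r ≤ (γ : EReal) := by
  -- The slack `γ - γ'` lets a power of `1 - r` swallow the random constant `M`.
  obtain ⟨γ', hγ1, hγ2⟩ := exists_between hγ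
  filter_upwards [ae_exists_saturatingPotential_le ht0 ht1 hγ1] with ω hω
  obtain ⟨M, hM, hle⟩ := hω
  have hlim : Tendsto (fun r : ℝ => 2 * 3 ^ (d + 1) * M * ENNReal.ofReal ((1 - r) ^ (γ - γ')))
      (𝓝[<] 1) (𝓝 0) := by
    have h1 : Tendsto (fun r : ℝ => (1 - r) ^ (γ - γ')) (𝓝[<] 1) (𝓝 0) := by
      have hc : ContinuousAt (fun r : ℝ => (1 - r) ^ (γ - γ')) 1 :=
        ContinuousAt.rpow_const (by fun_prop) (Or.inr (by linarith))
      have := hc.tendsto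
      rw [sub_self, Real.zero_rpow (by linarith)] at this
      exact this.mono_left nhdsWithin_le_nhds
    have h2 := ENNReal.Tendsto.const_mul (a := 2 * 3 ^ (d + 1) * M) (ENNReal.tendsto_ofReal h1)
      (Or.inr (ENNReal.mul_ne_top (by finiteness) hM))
    simpa using h2
  filter_upwards [eventually_Ioo_nhdsLT_one, hlim.eventually (gt_mem_nhds one_pos)] with r hr hr'
  rw [radialExponent_le_iff γ hr.1 hr.2]
  have h0 : 0 < 1 - r := sub_pos.2 hr.2
  have hsplit : (1 - r) ^ (-γ') = (1 - r) ^ (γ - γ') * (1 - r) ^ (-γ) := by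
    rw [← Real.rpow_add h0]; congr 1; ring
  calc ‖poissonIntegral (saturatingFunction d) (r • (spherePoint t ω : Space d))‖ₑ
      ≤ 2 * 3 ^ (d + 1) * saturatingPotential d (1 - r) (spherePoint t ω) :=
        enorm_poissonIntegral_le_saturatingPotential (norm_spherePoint t ω) hr.1 hr.2
    _ ≤ 2 * 3 ^ (d + 1) * (M * ENNReal.ofReal ((1 - r) ^ (-γ'))) := by
        gcongr
        exact hle _ h0 (by linarith [hr.1])
    _ = 2 * 3 ^ (d + 1) * M * ENNReal.ofReal ((1 - r) ^ (γ - γ')) *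
        ENNReal.ofReal ((1 - r) ^ (-γ)) := by
        rw [hsplit, ENNReal.ofReal_mul (by positivity)]; ring
    _ ≤ 1 * ENNReal.ofReal ((1 - r) ^ (-γ)) := by gcongr
    _ = _ := one_mul _

theorem ae_spherePoint_mem_limLevelSet {t : ℝ} (ht0 : 0 ≤ t) (ht1 : t ≤ 1) :
    ∀ᵐ ω ∂(coins d), (spherePoint t ω : Space d) ∈ limLevelSet (saturatingFunction d) (d * t) := by
  -- Only the upper bounds have exceptional null sets, so countably many exponents decreasing to `d
  -- t` are used; the lower bounds hold for every `ω`.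
  have hae : ∀ᵐ ω ∂(coins d), ∀ m : ℕ, ∀ᶠ r in 𝓝[<] (1 : ℝ),
      radialExponent (saturatingFunction d) (spherePoint t ω) r ≤
        ((d * t + 1 / ((m : ℝ) + 1) : ℝ) : EReal) :=
    ae_all_iff.2 fun m => ae_eventually_radialExponent_spherePoint_le ht0 ht1 <| by
      have : (0 : ℝ) < 1 / ((m : ℝ) + 1) := by positivity
      linarith
  filter_upwards [hae] with ω hω
  refine ⟨by simp, tendsto_order.2 ⟨fun a ha => ?_, fun b hb => ?_⟩⟩
  · obtain ⟨q, hq1, hq2⟩ := EReal.lt_iff_exists_real_btwn.1 ha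
    filter_upwards [eventually_le_radialExponent_spherePoint ht0 ht1 (EReal.coe_lt_coe_iff.1 hq2) ω]
      with r hr
    exact hq1.trans_le hr
  · obtain ⟨q, hq1, hq2⟩ := EReal.lt_iff_exists_real_btwn.1 hb
    obtain ⟨m, hm⟩ := exists_nat_one_div_lt (sub_pos.2 (EReal.coe_lt_coe_iff.1 hq1))
    filter_upwards [hω m] with r hr
    refine hr.trans_lt (lt_of_le_of_lt (EReal.coe_le_coe_iff.2 ?_) hq2)
    linarith

theorem le_dimH_limLevelSet (hd : 1 ≤ d) {β : ℝ} (hβ : β ∈ Icc (0 : ℝ) d) :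
    ENNReal.ofReal (d - β) ≤ dimH (limLevelSet (saturatingFunction d) β) := by
  have hd0 : (0 : ℝ) < d := by exact_mod_cast hd
  have h := ae_spherePoint_mem_limLevelSet (d := d) (t := β / d) (div_nonneg hβ.1 hd0.le)
    ((div_le_one hd0).2 hβ.2)
  rw [mul_div_cancel₀ _ hd0.ne'] at h
  have h2 := le_dimH_of_ae_spherePoint (div_nonneg hβ.1 hd0.le) ((div_le_one hd0).2 hβ.2) h
  rwa [mul_sub, mul_one, mul_div_cancel₀ _ hd0.ne'] at h2

theorem limLevelSet_subset {𝕜 : Type*} [RCLike 𝕜] (f : Sph d → 𝕜) (β : ℝ) :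
    limLevelSet f β ⊆ liminfLevelSet f β := fun _ hx => ⟨hx.1, hx.2.liminf_eq⟩

theorem liminfLevelSet_subset {𝕜 : Type*} [RCLike 𝕜] (f : Sph d → 𝕜) (β : ℝ) :
    liminfLevelSet f β ⊆ superLevelSet f β := fun _ hx => ⟨hx.1, hx.2.ge⟩

end RadialPoisson

theorem theorem2 (d : ℕ) (hd : 1 ≤ d) (𝕜 : Type*) [RCLike 𝕜] :
    (∀ f : RadialPoisson.Sph d → 𝕜, Integrable f (RadialPoisson.sigma d) →
      ∀ β : ℝ, β ∈ Set.Icc (0 : ℝ) (d : ℝ) →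
        Packing.dimP (RadialPoisson.superLevelSet f β) ≤ ENNReal.ofReal ((d : ℝ) - β)) ∧
    (∃ f : RadialPoisson.Sph d → ℝ, Integrable f (RadialPoisson.sigma d) ∧ (∀ ξ, 0 ≤ f ξ) ∧
      ∀ β : ℝ, β ∈ Set.Icc (0 : ℝ) (d : ℝ) →
        dimH (RadialPoisson.limLevelSet f β) = ENNReal.ofReal ((d : ℝ) - β) ∧
        Packing.dimP (RadialPoisson.limLevelSet f β) = ENNReal.ofReal ((d : ℝ) - β) ∧
        Packing.dimP (RadialPoisson.liminfLevelSet f β) = ENNReal.ofReal ((d : ℝ) - β)) := by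
  refine ⟨fun f hf β hβ => RadialPoisson.dimP_superLevelSet_le hf hβ.2,
    RadialPoisson.saturatingFunction d, RadialPoisson.integrable_saturatingFunction d,
    RadialPoisson.saturatingFunction_nonneg, fun β hβ => ?_⟩
  -- All the dimensions are squeezed in one chain: `d - β ≤ dimH E ≤ dimP E ≤ dimP E⁺ ≤ dimP ℰ⁺ ≤ d
  -- - β`.
  have h1 := RadialPoisson.le_dimH_limLevelSet hd hβ
  have h2 := Packing.dimH_le_dimP
    (RadialPoisson.limLevelSet (RadialPoisson.saturatingFunction d) β)
  have h3 := Packing.dimP_mono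
    (RadialPoisson.limLevelSet_subset (RadialPoisson.saturatingFunction d) β)
  have h4 := Packing.dimP_mono
    (RadialPoisson.liminfLevelSet_subset (RadialPoisson.saturatingFunction d) β)
  have h5 := RadialPoisson.dimP_superLevelSet_le
    (RadialPoisson.integrable_saturatingFunction d) hβ.2
  exact ⟨le_antisymm (h2.trans (h3.trans (h4.trans h5))) h1,
    le_antisymm (h3.trans (h4.trans h5)) (h1.trans h2),
    le_antisymm (h4.trans h5) (h1.trans (h2.trans h3))⟩
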